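/- Notation. On $\mathbb{R}^d$ let $W_2$ be the 2-Wasserstein distance, and for probability measures $P,Q$ with Lebesgue densities $f,g$ let $\langle P,Q\rangle_{L^2}=\int f g\,dx$. Given measures $X_1,\dots,X_N$ and $\beta>0$, put $w_j(\xi)=e^{-\beta W_2^2(X_j,\xi)}/\sum_{k=1}^N e^{-\beta W_2^2(X_k,\xi)}$ and $\Phi(\xi)=\big(\sum_{j=1}^N w_j(\xi)T_j\big)_\#\xi$, where $T_j$ is the optimal transport map from $\xi$ to $X_j$. Put $M_W=\max_i W_2(X_i,\delta_0)$ and, for $0<\lambda_{\min}\le\lambda_{\max}$, $C=4M_W^2+2d(\lambda_{\max}+\lambda_{\min})$. (Separation at $i$) $\min_{j\ne i}\big(-\log\langle X_i,X_j\rangle_{L^2}\big)\ \ge\ \frac d2\log(4\pi\lambda_{\max})+\frac1{\beta\lambda_{\min}}\log(CN^3\beta)$. (Temperature constraint) $CN^3\beta>e^2$. **Part 1.** Let $X_j=\mathcal N(\mu_j,\Sigma_j)$ ($1\le j\le N$) and $\xi=\mathcal N(m,\Omega)$ be Gaussian measures on $\mathbb{R}^d$ whose covariance matrices are positive definite, have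 all eigenvalues in $[\lambda_{\min},\lambda_{\max}]$, and satisfy $\Sigma_j\Sigma_k=\Sigma_k\Sigma_j$ and $\Sigma_j\Omega=\Omega\Sigma_j$ for all $j,k$. (In particular, the $X_j$ may be the output of the sampling algorithm of Part 2, for any radius $R$.) Let $i$ be an index at which separation holds, and assume the temperature constraint and $N>\max\{144\beta M_W^2,\ 1/(C\beta)\}$. If $W_2(X_i,\xi)\le 1/\sqrt{\beta N}$, then $$W_2(\Phi(\xi),X_i)\le \frac{3}{\sqrt{\beta N}}.$$ **Part 2.** Sampling algorithm with radius $R$: for a fixed orthogonal matrix $U$, draw, all independently for $j=1,\dots,N$, a vector $\lambda^{(j)}$ uniformly from the polytope $\{\lambda\in[\lambda_{\min},\lambda_{\max}]^d:\sum_k\lambda_k=R^2/2\}$ and a mean $\mu_j$ uniformly from the sphere of radius $R/\sqrt2$ centred at $0$, and put $X_j=\mathcal N(\mu_j,\,U\,\mathrm{diag}(\lambda^{(j)})\,U^T)$. Let $0<\lambda_{\min}<\lambda_{\max}$, $\gamma=\lambda_{\max}/\lambda_{\min}<\sqrt e$, $\alpha=1-2\log\gamma$ and $0<p<1$. Then there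 are $d_0\in\mathbb N$ and $K\in\mathbb{R}$, depending only on $p,\lambda_{\min},\lambda_{\max}$, such that for all $d>d_0$ and all $\beta>3\alpha/\lambda_{\min}$ the following holds with $N=\big\lfloor\sqrt{p/2}\,\exp(d\alpha^2/16)\big\rfloor$ and $R=\sqrt{d(\lambda_{\max}+\lambda_{\min})}$. First, $3/\sqrt{\beta N}\le K e^{-\alpha^2 d/32}$. Second, if $X_1,\dots,X_N$ are drawn by the sampling algorithm (with any $U$), then with probability at least $1-p$: separation holds at every $i$, the temperature constraint holds, and for every $i$ and every Gaussian $\xi=\mathcal N(m,\Omega)$ such that $\Omega$ is positive definite with eigenvalues in $[\lambda_{\min},\lambda_{\max}]$, $\Omega$ commutes with all the covariance matrices of the $X_j$, and $W_2(X_i,\xi)\le1/\sqrt{\beta N}$, $$W_2(\Phi(\xi),X_i)\le \frac{3}{\sqrt{\beta N}}\ \big(\le K e^{-\alpha^2 d/32}\big).$$ So with exponentially many patterns the one-step retrieval error is exponentially small in $d$. -/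

import Mathlib

open MeasureTheory ProbabilityTheory
open scoped ENNReal

namespace GaussianDAM

noncomputable section

/-- The couplings of two measures: measures on the product with the given marginals. -/
def couplings {d : ℕ} (P Q : Measure (EuclideanSpace ℝ (Fin d))) :
    Set (Measure (EuclideanSpace ℝ (Fin d) × EuclideanSpace ℝ (Fin d))) :=
  {c | c.map Prod.fst = P ∧ c.map Prod.snd = Q}

/-- The 2-Wasserstein distance on `ℝᵈ`, with values in `[0, ∞]`; it is finite between probability
measures with finite second moments. -/
def W2 {d : ℕ} (P Q : Measure (EuclideanSpace ℝ (Fin d))) : ℝ≥0∞ :=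
  (⨅ c ∈ couplings P Q, ∫⁻ z, edist z.1 z.2 ^ 2 ∂c) ^ (1 / 2 : ℝ)

/-- `T` is an optimal transport map from `P` to `Q` for the squared Euclidean distance. -/
def IsOptimalTransportMap {d : ℕ} (P Q : Measure (EuclideanSpace ℝ (Fin d)))
    (T : EuclideanSpace ℝ (Fin d) → EuclideanSpace ℝ (Fin d)) : Prop :=
  Measurable T ∧ P.map T = Q ∧ ∫⁻ x, edist x (T x) ^ 2 ∂P = W2 P Q ^ 2

open Classical in
/-- The optimal transport map from `P` to `Q` (for a nondegenerate Gaussian `P` it is unique up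
to `P`-null sets). It is the identity when there is no optimal transport map. -/
def transportMap {d : ℕ} (P Q : Measure (EuclideanSpace ℝ (Fin d))) :
    EuclideanSpace ℝ (Fin d) → EuclideanSpace ℝ (Fin d) :=
  if h : ∃ T, IsOptimalTransportMap P Q T then h.choose else id

/-- The Gibbs weights `w_j(ξ) = exp(-β W₂²(X_j, ξ)) / ∑ₖ exp(-β W₂²(X_k, ξ))`. -/
def weight {d N : ℕ} (β : ℝ) (X : Fin N → Measure (EuclideanSpace ℝ (Fin d)))
    (ξ : Measure (EuclideanSpace ℝ (Fin d))) (j : Fin N) : ℝ :=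
  Real.exp (-β * (W2 (X j) ξ).toReal ^ 2) / ∑ k, Real.exp (-β * (W2 (X k) ξ).toReal ^ 2)

/-- One retrieval step: `Φ(ξ) = (∑ⱼ w_j(ξ) T_j)_# ξ`, with `T_j` the optimal transport map from
`ξ` to `X_j`. -/
def Phi {d N : ℕ} (β : ℝ) (X : Fin N → Measure (EuclideanSpace ℝ (Fin d)))
    (ξ : Measure (EuclideanSpace ℝ (Fin d))) : Measure (EuclideanSpace ℝ (Fin d)) :=
  ξ.map (fun x => ∑ j, weight β X ξ j • transportMap ξ (X j) x)

/-- The `L²` inner product of two measures: the integral of the product of their Lebesgue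
densities. -/
def innerL2 {d : ℕ} (P Q : Measure (EuclideanSpace ℝ (Fin d))) : ℝ :=
  ∫ x, (P.rnDeriv volume x).toReal * (Q.rnDeriv volume x).toReal

/-- `M_W = maxᵢ W₂(X_i, δ₀)`. -/
def radiusMax {d N : ℕ} (X : Fin N → Measure (EuclideanSpace ℝ (Fin d))) : ℝ :=
  ⨆ i, (W2 (X i) (Measure.dirac 0)).toReal

/-- The constant `4 M_W² + 2 d (λ_max + λ_min)`. -/
def sizeConst {d N : ℕ} (lmin lmax : ℝ) (X : Fin N → Measure (EuclideanSpace ℝ (Fin d))) : ℝ :=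
  4 * radiusMax X ^ 2 + 2 * d * (lmax + lmin)

/-- The separation condition at the index `i`, a lower bound for
`min_{j ≠ i} (-log ⟨X_i, X_j⟩_{L²})`. -/
def SeparatedAt {d N : ℕ} (β lmin lmax : ℝ) (X : Fin N → Measure (EuclideanSpace ℝ (Fin d)))
    (i : Fin N) : Prop :=
  ∀ j, j ≠ i →
    (d : ℝ) / 2 * Real.log (4 * Real.pi * lmax)
        + 1 / (β * lmin) * Real.log ((N : ℝ) ^ 3 * β * sizeConst lmin lmax X)
      ≤ -Real.log (innerL2 (X i) (X j))

/-- The constraint on the temperature parameter, `(4 M_W² + 2 d (λ_max + λ_min)) N³ β > e²`. -/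
def TemperatureConstraint {d N : ℕ} (β lmin lmax : ℝ)
    (X : Fin N → Measure (EuclideanSpace ℝ (Fin d))) : Prop :=
  Real.exp 2 < sizeConst lmin lmax X * (N : ℝ) ^ 3 * β

/-- A positive definite matrix all of whose eigenvalues lie in `[λ_min, λ_max]`. -/
def CovarianceIn {d : ℕ} (lmin lmax : ℝ) (S : Matrix (Fin d) (Fin d) ℝ) : Prop :=
  S.PosDef ∧ spectrum ℝ S ⊆ Set.Icc lmin lmax

/-- The polytope of spectra `(λ_1, …, λ_d)` with `∑ λ_k = R² / 2` and
`λ_min ≤ λ_k ≤ λ_max`. -/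
def spectrumPolytope (d : ℕ) (R lmin lmax : ℝ) : Set (EuclideanSpace ℝ (Fin d)) :=
  {l | ∑ k, l k = R ^ 2 / 2 ∧ ∀ k, lmin ≤ l k ∧ l k ≤ lmax}

/-- The uniform distribution on the polytope: its `(d - 1)`-dimensional Hausdorff measure,
normalised to total mass one. -/
def uniformPolytope (d : ℕ) (R lmin lmax : ℝ) : Measure (EuclideanSpace ℝ (Fin d)) :=
  ProbabilityTheory.cond (Measure.hausdorffMeasure ((d : ℝ) - 1)) (spectrumPolytope d R lmin lmax)

/-- The uniform distribution on the centred sphere of radius `ρ`: the normalised surface measure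
of the unit sphere, scaled by `ρ`. -/
def uniformSphere (d : ℕ) (ρ : ℝ) : Measure (EuclideanSpace ℝ (Fin d)) :=
  (((volume : Measure (EuclideanSpace ℝ (Fin d))).toSphere Set.univ)⁻¹ •
    (volume : Measure (EuclideanSpace ℝ (Fin d))).toSphere).map (fun u => ρ • u.1)

/-- The random choices of the sampling algorithm on the Wasserstein sphere of radius `R`:
for each of the `N` patterns a spectrum that is uniform on the polytope and a mean that is uniform
on the sphere of radius `R / √2`, all of them independent. -/
structure IsSample {Ω : Type*} [MeasurableSpace Ω] {d N : ℕ} (R lmin lmax : ℝ)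
    (P : Measure Ω) (mean spec : Fin N → Ω → EuclideanSpace ℝ (Fin d)) : Prop where
  spec_law : ∀ i, HasLaw (spec i) (uniformPolytope d R lmin lmax) P
  mean_law : ∀ i, HasLaw (mean i) (uniformSphere d (R / √2)) P
  indep : iIndepFun (Sum.elim mean spec) P

/-- The covariance matrix `U diag(l) Uᵀ`. -/
def covOf {d : ℕ} (U : Matrix (Fin d) (Fin d) ℝ) (l : EuclideanSpace ℝ (Fin d)) :
    Matrix (Fin d) (Fin d) ℝ :=
  U * Matrix.diagonal (fun k => l k) * U.transpose

/-- The number of patterns `N = ⌊√(p/2) exp(d α² / 16)⌋`. -/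
def numPatterns (p α : ℝ) (d : ℕ) : ℕ :=
  ⌊√(p / 2) * Real.exp (d * α ^ 2 / 16)⌋₊

end

end GaussianDAM

/-! Retrieval rests on one estimate. The Gibbs weights sum to one and `Φ(ξ)` and `X_i` are both
push-forwards of `ξ`, so coupling them through `ξ` gives `W₂(Φ(ξ), X_i) ≤ ∑_j w_j ‖T_j - T_i‖` in
`L²(ξ)`. Since `‖T_j‖ = W₂(X_j, δ₀) ≤ M_W`, this is at most `2 M_W N ε` once every weight with `j ≠
i` is at most `ε` (`W2_Phi_le_of_weight_le`). Such a weight is at most `exp(-β (W₂²(X_j, ξ) -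
W₂²(X_i, ξ)))`. As `W₂` dominates the distance `‖·‖` of means, the triangle inequality for means
bounds the exponent by `-β (D² - 2 D r)`, where `D` is the distance between the means of `X_i` and
`X_j` and `r ≤ D` bounds `W₂(X_i, ξ)` (`W2_Phi_le`). Covariances enter only through commutation,
which gives a common eigenbasis and hence an explicit optimal map.

In a common eigenbasis the `L²` inner product of two Gaussians factorises, so `-log ⟨X_i, X_j⟩` is a
log-determinant term plus a weighted square of the mean difference. The eigenvalue bounds turn this
into two-sided control by `D²` (`neg_log_innerL2_bounds`). The upper bound makes separation a lower
bound on `D` (Part 1); the lower bound derives separation from a lower bound on `D` (Part 2).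

For random patterns, a spherical cap estimate (`toSphere_cap_le`) and a union bound over pairs make
all correlations of means at most `α/2` with probability at least `1 - p`, so `D² ≥ d (λ_max +
λ_min)(1 - α/2)`. Passing from `λ_max` to `λ_min` in the log-determinant costs `d (1 - α)/4`, while
the means contribute at least `d (1 - α/2)/4`; the surplus `d α/8` absorbs the logarithm in the
separation condition. The retrieval bound of Part 2 uses this `D` directly instead of Part 1, whose
condition `N > 144 β M_W²` fails for large `β`. -/

namespace GaussianDAM

/-! ### Simultaneous diagonalisation and Gaussians in a common eigenbasis -/

open Module.End in
theorem exists_orthonormalBasis_joint_eigenvectors {d : ℕ}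
    {A B : EuclideanSpace ℝ (Fin d) →ₗ[ℝ] EuclideanSpace ℝ (Fin d)}
    (hA : A.IsSymmetric) (hB : B.IsSymmetric) (hAB : Commute A B) :
    ∃ (b : OrthonormalBasis (Fin d) ℝ (EuclideanSpace ℝ (Fin d))) (u v : Fin d → ℝ),
      (∀ k, A (b k) = u k • b k) ∧ (∀ k, B (b k) = v k • b k) := by
  classical
  -- Indexing by actual eigenvalues keeps the index type finite, as a subordinate basis requires;
  -- all other joint eigenspaces vanish.
  let V : Eigenvalues A × Eigenvalues B → Submodule ℝ (EuclideanSpace ℝ (Fin d)) :=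
    fun i => eigenspace A i.1 ⊓ eigenspace B i.2
  have hV' : OrthogonalFamily ℝ (fun i => V i) fun i => (V i).subtypeₗᵢ := by
    have h := LinearMap.IsSymmetric.orthogonalFamily_eigenspace_inf_eigenspace hA hB
    -- The library family lists the eigenvalue of the second operator first, hence the swap.
    exact h.comp (γ := Eigenvalues A × Eigenvalues B) (f := fun i => ((i.2 : ℝ), (i.1 : ℝ)))
      (fun i j hij => by
        simp only [Prod.mk.injEq] at hij
        exact Prod.ext (Subtype.ext hij.2) (Subtype.ext hij.1))
  have hV : DirectSum.IsInternal V := by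
    rw [OrthogonalFamily.isInternal_iff hV', Submodule.orthogonal_eq_bot_iff, eq_top_iff,
      ← LinearMap.IsSymmetric.iSup_iSup_eigenspace_inf_eigenspace_eq_top_of_commute hA hB hAB]
    refine iSup_le fun α => iSup_le fun γ => ?_
    by_cases hα : HasEigenvalue A α
    · by_cases hγ : HasEigenvalue B γ
      · exact le_iSup V (⟨α, hα⟩, ⟨γ, hγ⟩)
      · have : eigenspace B γ = ⊥ := by simpa [HasEigenvalue, HasUnifEigenvalue] using hγ
        simp [this]
    · have : eigenspace A α = ⊥ := by simpa [HasEigenvalue, HasUnifEigenvalue] using hα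
      simp [this]
  have hn : Module.finrank ℝ (EuclideanSpace ℝ (Fin d)) = d := by simp
  refine ⟨hV.subordinateOrthonormalBasis hn hV',
    fun k => (hV.subordinateOrthonormalBasisIndex hn k hV').1,
    fun k => (hV.subordinateOrthonormalBasisIndex hn k hV').2, fun k => ?_, fun k => ?_⟩
  · exact mem_eigenspace_iff.1 (hV.subordinateOrthonormalBasis_subordinate hn k hV').1
  · exact mem_eigenspace_iff.1 (hV.subordinateOrthonormalBasis_subordinate hn k hV').2

theorem eigenvalue_mem_Icc {d : ℕ} {lmin lmax : ℝ} {S : Matrix (Fin d) (Fin d) ℝ}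
    (hS : CovarianceIn lmin lmax S) {x : EuclideanSpace ℝ (Fin d)} (hx : x ≠ 0) {u : ℝ}
    (h : Matrix.toEuclideanLin S x = u • x) : u ∈ Set.Icc lmin lmax := by
  apply hS.2
  rw [← Matrix.spectrum_toLpLin 2]
  exact (Module.End.hasEigenvalue_of_hasEigenvector
    ⟨Module.End.mem_eigenspace_iff.2 h, hx⟩).mem_spectrum

theorem exists_orthonormalBasis_of_commute {d : ℕ} {lmin lmax : ℝ}
    {S S' : Matrix (Fin d) (Fin d) ℝ} (hS : CovarianceIn lmin lmax S)
    (hS' : CovarianceIn lmin lmax S') (h : Commute S S') :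
    ∃ (b : OrthonormalBasis (Fin d) ℝ (EuclideanSpace ℝ (Fin d))) (u v : Fin d → ℝ),
      (∀ k, Matrix.toEuclideanLin S (b k) = u k • b k) ∧
      (∀ k, Matrix.toEuclideanLin S' (b k) = v k • b k) ∧
      (∀ k, u k ∈ Set.Icc lmin lmax) ∧ (∀ k, v k ∈ Set.Icc lmin lmax) := by
  obtain ⟨b, u, v, hu, hv⟩ := exists_orthonormalBasis_joint_eigenvectors
    (Matrix.isSymmetric_toEuclideanLin_iff.2 hS.1.isHermitian)
    (Matrix.isSymmetric_toEuclideanLin_iff.2 hS'.1.isHermitian)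
    (show Commute (Matrix.toEuclideanLin S) (Matrix.toEuclideanLin S') by
      ext x k
      simp [Matrix.toLpLin_apply, Matrix.mulVec_mulVec, h.eq])
  exact ⟨b, u, v, hu, hv, fun k => eigenvalue_mem_Icc hS (b.orthonormal.ne_zero k) (hu k),
    fun k => eigenvalue_mem_Icc hS' (b.orthonormal.ne_zero k) (hv k)⟩

/-- The Gaussian measure whose coordinates in the orthonormal basis `b` are independent with means
`ν k` and variances `l k`. -/
noncomputable def gaussianIn {d : ℕ} (b : OrthonormalBasis (Fin d) ℝ (EuclideanSpace ℝ (Fin d)))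
    (ν l : Fin d → ℝ) : Measure (EuclideanSpace ℝ (Fin d)) :=
  ((Measure.pi fun k => gaussianReal (ν k) (l k).toNNReal).map (WithLp.toLp 2)).map b.repr.symm

/-- Characteristic functions agree: in an eigenbasis of `S` the quadratic form is `∑ l_k t_k²`, so
the exponential splits into one-dimensional Gaussian factors. -/
theorem multivariateGaussian_eq_gaussianIn {d : ℕ}
    (b : OrthonormalBasis (Fin d) ℝ (EuclideanSpace ℝ (Fin d)))
    (μ : EuclideanSpace ℝ (Fin d)) {S : Matrix (Fin d) (Fin d) ℝ} (hS : S.PosSemidef)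
    {l : Fin d → ℝ} (hl : ∀ k, 0 ≤ l k) (h : ∀ k, Matrix.toEuclideanLin S (b k) = l k • b k) :
    multivariateGaussian μ S = gaussianIn b (fun k => b.repr μ k) l := by
  have : IsProbabilityMeasure ((Measure.pi fun k => gaussianReal (b.repr μ k) (l k).toNNReal).map
      (WithLp.toLp 2)) := Measure.isProbabilityMeasure_map (by fun_prop)
  have : IsProbabilityMeasure (gaussianIn b (fun k => b.repr μ k) l) :=
    Measure.isProbabilityMeasure_map (by fun_prop)
  apply Measure.ext_of_charFun
  ext t
  have h1 : charFun (gaussianIn b (fun k => b.repr μ k) l) t =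
      charFun ((Measure.pi fun k => gaussianReal (b.repr μ k) (l k).toNNReal).map
      (WithLp.toLp 2)) (b.repr t) := by
    rw [gaussianIn, charFun_apply, charFun_apply, integral_map (by fun_prop) (by fun_prop)]
    congr with x
    rw [← b.repr.inner_map_map, LinearIsometryEquiv.apply_symm_apply]
  rw [h1, charFun_pi, charFun_multivariateGaussian hS]
  simp_rw [charFun_gaussianReal, ← Complex.exp_sum]
  congr 1
  rw [Finset.sum_sub_distrib, ← Finset.sum_mul]
  congr 1
  · rw [← b.repr.inner_map_map, PiLp.inner_apply]
    simp [mul_comm]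
  · have h2 : Matrix.toEuclideanLin S t = ∑ k, (l k * b.repr t k) • b k := by
      conv_lhs => rw [← b.sum_repr t]
      simp [map_sum, h, smul_smul, mul_comm]
    have h3 : (t : Fin d → ℝ) ⬝ᵥ S.mulVec t = ∑ k, l k * b.repr t k ^ 2 := by
      have h4 : (t : Fin d → ℝ) ⬝ᵥ S.mulVec t = inner ℝ (Matrix.toEuclideanLin S t) t := by
        simp [PiLp.inner_apply, Matrix.toLpLin_apply, dotProduct]
      rw [h4, h2, sum_inner]
      refine Finset.sum_congr rfl fun k _ => ?_
      rw [real_inner_smul_left, ← b.repr_apply_apply]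
      ring
    rw [h3, Complex.ofReal_sum, Finset.sum_div]
    refine Finset.sum_congr rfl fun k _ => ?_
    simp [hl k]

/-! ### Densities and the `L²` inner product of Gaussians -/

theorem pi_withDensity_ofReal {ι : Type*} [Fintype ι] {f : ι → ℝ → ℝ} (hf : ∀ i x, 0 ≤ f i x)
    (hfi : ∀ i, Integrable (f i)) :
    (Measure.pi fun i => (volume : Measure ℝ).withDensity fun x => ENNReal.ofReal (f i x)) =
      (volume : Measure (ι → ℝ)).withDensity fun x => ENNReal.ofReal (∏ i, f i (x i)) := by
  have (i : ι) : IsFiniteMeasure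
      ((volume : Measure ℝ).withDensity fun x => ENNReal.ofReal (f i x)) :=
    isFiniteMeasure_withDensity_ofReal (hfi i).2
  refine Measure.pi_eq fun s hs => ?_
  rw [withDensity_apply _ (.univ_pi hs), volume_pi, Measure.restrict_pi_pi,
    ← ofReal_integral_eq_lintegral_ofReal (.fintype_prod fun i => (hfi i).restrict)
      (ae_of_all _ fun x => Finset.prod_nonneg fun i _ => hf i _),
    integral_fintype_prod_eq_prod,
    ENNReal.ofReal_prod_of_nonneg fun i _ => integral_nonneg fun x => hf i x]
  refine Finset.prod_congr rfl fun i _ => ?_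
  rw [withDensity_apply _ (hs i), ofReal_integral_eq_lintegral_ofReal (hfi i).restrict
    (ae_of_all _ fun x => hf i x)]

theorem gaussianIn_eq_withDensity {d : ℕ}
    (b : OrthonormalBasis (Fin d) ℝ (EuclideanSpace ℝ (Fin d))) (ν : Fin d → ℝ) {l : Fin d → ℝ}
    (hl : ∀ k, 0 < l k) :
    gaussianIn b ν l = volume.withDensity
      fun x => ENNReal.ofReal (∏ k, gaussianPDFReal (ν k) (l k).toNNReal (b.repr x k)) := by
  have h0 : (Measure.pi fun k => gaussianReal (ν k) (l k).toNNReal) =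
      volume.withDensity
        fun x => ENNReal.ofReal (∏ k, gaussianPDFReal (ν k) (l k).toNNReal (x k)) := by
    rw [← pi_withDensity_ofReal (f := fun k => gaussianPDFReal (ν k) (l k).toNNReal)
      (fun k x => gaussianPDFReal_nonneg _ _ _)
      (fun k => integrable_gaussianPDFReal _ _)]
    congr with k : 1
    rw [gaussianReal_of_var_ne_zero _ (by simpa using hl k)]
    rfl
  have hmp : MeasurePreserving (fun x : Fin d → ℝ => b.repr.symm (WithLp.toLp 2 x)) :=
    b.measurePreserving_repr_symm.comp (PiLp.volume_preserving_toLp (Fin d))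
  have hm : Measurable fun x : EuclideanSpace ℝ (Fin d) =>
      ENNReal.ofReal (∏ k, gaussianPDFReal (ν k) (l k).toNNReal (b.repr x k)) := by
    refine ENNReal.measurable_ofReal.comp (Finset.measurable_prod _ fun k _ => ?_)
    exact (measurable_gaussianPDFReal _ _).comp (by fun_prop)
  rw [gaussianIn, Measure.map_map (by fun_prop) (by fun_prop), h0]
  ext s hs
  rw [Measure.map_apply (by fun_prop) hs, Function.comp_def, withDensity_apply _ hs,
    withDensity_apply _ (hmp.measurable hs), ← hmp.setLIntegral_comp_preimage hs hm]
  simp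

/-- Completing the square in `x`: the factor free of `x` is what survives integration. -/
theorem gaussianPDFReal_mul_gaussianPDFReal (a b x : ℝ) {v w : ℝ} (hv : 0 < v) (hw : 0 < w) :
    gaussianPDFReal a v.toNNReal x * gaussianPDFReal b w.toNNReal x =
      gaussianPDFReal a (v + w).toNNReal b *
        gaussianPDFReal ((a * w + b * v) / (v + w)) (v * w / (v + w)).toNNReal x := by
  have hs : 0 < v + w := by positivity
  have hq : 0 < v * w / (v + w) := by positivity
  simp only [gaussianPDFReal, Real.coe_toNNReal _ hv.le, Real.coe_toNNReal _ hw.le,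
    Real.coe_toNNReal _ hs.le, Real.coe_toNNReal _ hq.le]
  rw [mul_mul_mul_comm, mul_mul_mul_comm (√(2 * Real.pi * (v + w)))⁻¹, ← Real.exp_add, ← Real.exp_add, ← mul_inv, ← mul_inv,
    ← Real.sqrt_mul (by positivity), ← Real.sqrt_mul (by positivity)]
  congr 1
  · congr 2
    field_simp
  · congr 1
    field_simp
    ring

theorem integral_gaussianPDFReal_mul (a b : ℝ) {v w : ℝ} (hv : 0 < v) (hw : 0 < w) :
    ∫ x, gaussianPDFReal a v.toNNReal x * gaussianPDFReal b w.toNNReal x =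
      gaussianPDFReal a (v + w).toNNReal b := by
  have hq : 0 < v * w / (v + w) := by positivity
  simp_rw [gaussianPDFReal_mul_gaussianPDFReal a b _ hv hw]
  rw [integral_const_mul, integral_gaussianPDFReal_eq_one _ (by simpa using hq), mul_one]

theorem innerL2_gaussianIn {d : ℕ}
    (b : OrthonormalBasis (Fin d) ℝ (EuclideanSpace ℝ (Fin d))) (ν ν' : Fin d → ℝ)
    {l l' : Fin d → ℝ} (hl : ∀ k, 0 < l k) (hl' : ∀ k, 0 < l' k) :
    innerL2 (gaussianIn b ν l) (gaussianIn b ν' l') =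
      ∏ k, gaussianPDFReal (ν k) (l k + l' k).toNNReal (ν' k) := by
  have key (ν l : Fin d → ℝ) (hl : ∀ k, 0 < l k) :
      (fun x => ((gaussianIn b ν l).rnDeriv volume x).toReal) =ᵐ[volume]
        fun x => ∏ k, gaussianPDFReal (ν k) (l k).toNNReal (b.repr x k) := by
    rw [gaussianIn_eq_withDensity b ν hl]
    have hm : Measurable fun x : EuclideanSpace ℝ (Fin d) =>
        ENNReal.ofReal (∏ k, gaussianPDFReal (ν k) (l k).toNNReal (b.repr x k)) := by
      refine ENNReal.measurable_ofReal.comp (Finset.measurable_prod _ fun k _ => ?_)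
      exact (measurable_gaussianPDFReal _ _).comp (by fun_prop)
    filter_upwards [Measure.rnDeriv_withDensity volume hm] with x hx
    rw [hx, ENNReal.toReal_ofReal (Finset.prod_nonneg fun k _ => gaussianPDFReal_nonneg _ _ _)]
  have hmp : MeasurePreserving (fun x : Fin d → ℝ => b.repr.symm (WithLp.toLp 2 x)) :=
    b.measurePreserving_repr_symm.comp (PiLp.volume_preserving_toLp (Fin d))
  have he : MeasurableEmbedding (fun x : Fin d → ℝ => b.repr.symm (WithLp.toLp 2 x)) :=
    (b.repr.symm.toHomeomorph.measurableEmbedding).comp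
      (MeasurableEquiv.toLp 2 (Fin d → ℝ)).measurableEmbedding
  have hmul := integral_congr_ae ((key ν l hl).mul (key ν' l' hl'))
  simp only [Pi.mul_apply] at hmul
  rw [innerL2, hmul, ← hmp.integral_comp he]
  simp_rw [LinearIsometryEquiv.apply_symm_apply, ← Finset.prod_mul_distrib]
  rw [integral_fintype_prod_volume_eq_prod (f := fun k x =>
    gaussianPDFReal (ν k) (l k).toNNReal x * gaussianPDFReal (ν' k) (l' k).toNNReal x)]
  exact Finset.prod_congr rfl fun k _ => integral_gaussianPDFReal_mul _ _ (hl k) (hl' k)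

theorem neg_log_gaussianPDFReal (a b : ℝ) {v : ℝ} (hv : 0 < v) :
    -Real.log (gaussianPDFReal a v.toNNReal b) =
      1 / 2 * Real.log (2 * Real.pi * v) + (a - b) ^ 2 / (2 * v) := by
  rw [gaussianPDFReal, Real.coe_toNNReal _ hv.le, Real.log_mul (by positivity) (by positivity),
    Real.log_exp, Real.log_inv, Real.log_sqrt (by positivity)]
  ring

/-- In a joint eigenbasis each coordinate contributes `½ log(2π(u+v)) + Δ²/(2(u+v))`, and `u + v`
lies in `[2 λ_min, 2 λ_max]`. The two terms are bounded separately, using opposite ends of this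
interval. -/
theorem neg_log_innerL2_bounds {d : ℕ} {lmin lmax : ℝ} (hlmin : 0 < lmin)
    {S S' : Matrix (Fin d) (Fin d) ℝ} (hS : CovarianceIn lmin lmax S)
    (hS' : CovarianceIn lmin lmax S') (h : Commute S S') (μ μ' : EuclideanSpace ℝ (Fin d)) :
    -Real.log (innerL2 (multivariateGaussian μ S) (multivariateGaussian μ' S')) ≤
        d / 2 * Real.log (4 * Real.pi * lmax) + ‖μ - μ'‖ ^ 2 / (4 * lmin) ∧
      d / 2 * Real.log (4 * Real.pi * lmin) + ‖μ - μ'‖ ^ 2 / (4 * lmax) ≤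
        -Real.log (innerL2 (multivariateGaussian μ S) (multivariateGaussian μ' S')) := by
  obtain ⟨b, u, v, hu, hv, hu', hv'⟩ := exists_orthonormalBasis_of_commute hS hS' h
  have hu0 k : 0 < u k := hlmin.trans_le (hu' k).1
  have hv0 k : 0 < v k := hlmin.trans_le (hv' k).1
  rw [multivariateGaussian_eq_gaussianIn b μ hS.1.posSemidef (fun k => (hu0 k).le) hu,
    multivariateGaussian_eq_gaussianIn b μ' hS'.1.posSemidef (fun k => (hv0 k).le) hv,
    innerL2_gaussianIn b _ _ hu0 hv0, Real.log_prod (fun k _ => (gaussianPDFReal_pos _ _ _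
      (by simpa using add_pos (hu0 k) (hv0 k))).ne'), ← Finset.sum_neg_distrib]
  have hn : ‖μ - μ'‖ ^ 2 = ∑ k, (b.repr μ k - b.repr μ' k) ^ 2 := by
    rw [← b.repr.norm_map, EuclideanSpace.real_norm_sq_eq]
    simp
  have hc (c : ℝ) : d / 2 * c = ∑ k : Fin d, 1 / 2 * c := by simp; ring
  simp_rw [neg_log_gaussianPDFReal _ _ (add_pos (hu0 _) (hv0 _))]
  rw [hn, Finset.sum_div, Finset.sum_div, hc, hc, ← Finset.sum_add_distrib,
    ← Finset.sum_add_distrib]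
  constructor
  · refine Finset.sum_le_sum fun k _ => add_le_add ?_ ?_
    · have := add_pos (hu0 k) (hv0 k)
      refine mul_le_mul_of_nonneg_left (Real.log_le_log (by positivity) ?_) (by norm_num)
      nlinarith [(hu' k).2, (hv' k).2, Real.pi_pos]
    · refine div_le_div_of_nonneg_left (sq_nonneg _) (by positivity) ?_
      linarith [(hu' k).1, (hv' k).1]
  · refine Finset.sum_le_sum fun k _ => add_le_add ?_ ?_
    · refine mul_le_mul_of_nonneg_left (Real.log_le_log (by positivity) ?_) (by norm_num)
      nlinarith [(hu' k).1, (hv' k).1, Real.pi_pos]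
    · have := add_pos (hu0 k) (hv0 k)
      refine div_le_div_of_nonneg_left (sq_nonneg _) (by positivity) ?_
      linarith [(hu' k).2, (hv' k).2]

/-! ### Couplings, weak duality and elementary facts on `W₂` -/

section Transport

variable {d : ℕ} {P Q : Measure (EuclideanSpace ℝ (Fin d))}

theorem ofReal_integral_le_lintegral_ofReal {α : Type*} [MeasurableSpace α] {μ : Measure α}
    {f : α → ℝ} (hf : Integrable f μ) :
    ENNReal.ofReal (∫ x, f x ∂μ) ≤ ∫⁻ x, ENNReal.ofReal (f x) ∂μ := by
  rw [integral_eq_lintegral_pos_part_sub_lintegral_neg_part hf]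
  exact (ENNReal.ofReal_le_ofReal (sub_le_self _ ENNReal.toReal_nonneg)).trans
    ENNReal.ofReal_toReal_le

theorem W2_sq (P Q : Measure (EuclideanSpace ℝ (Fin d))) :
    W2 P Q ^ 2 = ⨅ c ∈ couplings P Q, ∫⁻ z, edist z.1 z.2 ^ 2 ∂c := by
  rw [W2, ← ENNReal.rpow_natCast, ← ENNReal.rpow_mul]
  norm_num

theorem W2_sq_le_lintegral {c : Measure (EuclideanSpace ℝ (Fin d) × EuclideanSpace ℝ (Fin d))}
    (hc : c ∈ couplings P Q) : W2 P Q ^ 2 ≤ ∫⁻ z, edist z.1 z.2 ^ 2 ∂c := by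
  rw [W2_sq]
  exact iInf₂_le c hc

/-- Weak Kantorovich duality. -/
theorem ofReal_integral_add_integral_le_W2_sq {f g : EuclideanSpace ℝ (Fin d) → ℝ}
    (hf : Integrable f P) (hg : Integrable g Q) (hfg : ∀ x y, f x + g y ≤ ‖x - y‖ ^ 2) :
    ENNReal.ofReal (∫ x, f x ∂P + ∫ y, g y ∂Q) ≤ W2 P Q ^ 2 := by
  rw [W2_sq]
  refine le_iInf₂ fun c hc => ?_
  obtain ⟨rfl, rfl⟩ := hc
  have hf' : Integrable (fun z => f z.1) c := hf.comp_measurable measurable_fst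
  have hg' : Integrable (fun z => g z.2) c := hg.comp_measurable measurable_snd
  rw [integral_map measurable_fst.aemeasurable hf.1, integral_map measurable_snd.aemeasurable hg.1,
    ← integral_add hf' hg']
  refine (ofReal_integral_le_lintegral_ofReal (hf'.add hg')).trans (lintegral_mono fun z => ?_)
  rw [edist_dist, ← ENNReal.ofReal_pow dist_nonneg, dist_eq_norm]
  exact ENNReal.ofReal_le_ofReal (hfg _ _)

theorem map_prodMk_mem_couplings {S T : EuclideanSpace ℝ (Fin d) → EuclideanSpace ℝ (Fin d)}
    (hS : Measurable S) (hT : Measurable T) :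
    P.map (fun x => (S x, T x)) ∈ couplings (P.map S) (P.map T) := by
  constructor <;> rw [Measure.map_map (by fun_prop) (by fun_prop)] <;> rfl

theorem W2_map_sq_le {S T : EuclideanSpace ℝ (Fin d) → EuclideanSpace ℝ (Fin d)}
    (hS : Measurable S) (hT : Measurable T) :
    W2 (P.map S) (P.map T) ^ 2 ≤ ∫⁻ x, edist (S x) (T x) ^ 2 ∂P := by
  refine (W2_sq_le_lintegral (map_prodMk_mem_couplings hS hT)).trans_eq ?_
  rw [lintegral_map (by fun_prop) (by fun_prop)]

/-- Complementary slackness: potentials that are tight on the graph of `T` make the dual value equal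
to the cost of `T`. -/
theorem isOptimalTransportMap_of_potentials
    {T : EuclideanSpace ℝ (Fin d) → EuclideanSpace ℝ (Fin d)} (hT : Measurable T)
    (hPQ : P.map T = Q) {f g : EuclideanSpace ℝ (Fin d) → ℝ}
    (hf : Integrable f P) (hg : Integrable g Q) (hfg : ∀ x y, f x + g y ≤ ‖x - y‖ ^ 2)
    (hfT : ∀ x, f x + g (T x) = ‖x - T x‖ ^ 2) : IsOptimalTransportMap P Q T := by
  refine ⟨hT, hPQ, le_antisymm ?_ ?_⟩
  · refine le_trans (le_of_eq ?_) (ofReal_integral_add_integral_le_W2_sq hf hg hfg)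
    subst hPQ
    have hg' : Integrable (fun x => g (T x)) P := hg.comp_measurable hT
    have hfg' : Integrable (fun x => f x + g (T x)) P := hf.add hg'
    rw [integral_map hT.aemeasurable hg.1, ← integral_add hf hg',
      ofReal_integral_eq_lintegral_ofReal hfg'
        (ae_of_all _ fun x => by simp [hfT x])]
    refine lintegral_congr fun x => ?_
    rw [edist_dist, ← ENNReal.ofReal_pow dist_nonneg, dist_eq_norm, ← hfT]
  · have := W2_map_sq_le (P := P) measurable_id hT
    rwa [Measure.map_id, hPQ] at this

theorem W2_lt_top [IsProbabilityMeasure P] [IsProbabilityMeasure Q] (hP : MemLp id 2 P)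
    (hQ : MemLp id 2 Q) : W2 P Q < ∞ := by
  have h1 : MemLp (fun z : EuclideanSpace ℝ (Fin d) × EuclideanSpace ℝ (Fin d) => z.1 - z.2) 2
      (P.prod Q) := (hP.comp_fst Q).sub (hQ.comp_snd P)
  have h2 : W2 P Q ^ 2 < ∞ := by
    refine (W2_sq_le_lintegral (c := P.prod Q) ⟨?_, ?_⟩).trans_lt ?_
    · simp
    · simp
    · have := h1.eLpNorm_lt_top
      rw [eLpNorm_lt_top_iff_lintegral_rpow_enorm_lt_top (by norm_num) (by norm_num)] at this
      simpa [edist_eq_enorm_sub] using this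
  simpa using h2

/-- Duality with affine potentials in the direction `v` of the mean difference. Feasibility is `‖x -
y - v‖² ≥ 0`, and the dual value is `‖v‖²`. -/
theorem ofReal_norm_sub_le_W2 [IsProbabilityMeasure P] [IsProbabilityMeasure Q]
    (hP : Integrable id P) (hQ : Integrable id Q) :
    ENNReal.ofReal ‖∫ x, x ∂P - ∫ x, x ∂Q‖ ≤ W2 P Q := by
  set v := ∫ x, x ∂P - ∫ x, x ∂Q with hv
  have h := ofReal_integral_add_integral_le_W2_sq (P := P) (Q := Q)
    (f := fun x => 2 * inner ℝ v x - ‖v‖ ^ 2) (g := fun y => -2 * inner ℝ v y)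
    (((hP.const_inner v).const_mul 2).sub (integrable_const _)) ((hQ.const_inner v).const_mul _)
    (fun x y => by
      have h1 := norm_sub_sq_real (x - y) v
      rw [real_inner_comm, inner_sub_right] at h1
      nlinarith [sq_nonneg ‖x - y - v‖])
  have h2 : ∫ x, (2 * inner ℝ v x - ‖v‖ ^ 2) ∂P + ∫ y, (-2 * inner ℝ v y) ∂Q = ‖v‖ ^ 2 := by
    rw [integral_sub ((hP.const_inner v).const_mul 2) (integrable_const _), integral_const_mul,
      integral_const_mul, show ∫ x, inner ℝ v x ∂P = _ from integral_inner hP v,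
      show ∫ x, inner ℝ v x ∂Q = _ from integral_inner hQ v, integral_const]
    have : inner ℝ v (∫ x, x ∂P) - inner ℝ v (∫ x, x ∂Q) = ‖v‖ ^ 2 := by
      rw [← inner_sub_right, ← hv, real_inner_self_eq_norm_sq]
    simp only [id, probReal_univ, one_smul]
    linarith
  rw [h2, ENNReal.ofReal_pow (norm_nonneg _)] at h
  exact (ENNReal.pow_le_pow_left_iff (by norm_num)).1 h

/-- Every coupling with a Dirac mass has second coordinate almost surely zero, so all couplings have
the same cost. -/
theorem W2_dirac_zero [IsProbabilityMeasure P] : W2 P (Measure.dirac 0) = eLpNorm id 2 P := by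
  have h1 : W2 P (Measure.dirac 0) ^ 2 = ∫⁻ x, ‖x‖ₑ ^ 2 ∂P := by
    refine le_antisymm ?_ ?_
    · have := W2_map_sq_le (P := P) measurable_id (measurable_const (a := 0))
      simpa using this
    · rw [W2_sq]
      refine le_iInf₂ fun c hc => ?_
      have h2 : ∀ᵐ z ∂c, z.2 = 0 := by
        have : ∀ᵐ y ∂(c.map Prod.snd), y = 0 := by rw [hc.2]; simp [ae_dirac_eq]
        exact ae_of_ae_map measurable_snd.aemeasurable this
      rw [← hc.1, lintegral_map (by fun_prop) measurable_fst]
      refine (lintegral_congr_ae ?_).le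
      filter_upwards [h2] with z hz
      simp [hz]
  rw [eLpNorm_eq_lintegral_rpow_enorm_toReal (by norm_num) (by norm_num)]
  simp only [ENNReal.toReal_ofNat, id, ENNReal.rpow_ofNat]
  rw [← h1, ← ENNReal.rpow_natCast, ← ENNReal.rpow_mul]
  norm_num

end Transport

/-! ### Optimal maps between Gaussians and the abstract retrieval estimate -/

section Retrieval

variable {d : ℕ} {P Q : Measure (EuclideanSpace ℝ (Fin d))}

/-- An increasing affine map in each coordinate is the gradient of a convex quadratic. The
potentials are chosen so that the duality slack in each coordinate is `(y - a x - c)² / a`. -/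
theorem isOptimalTransportMap_of_diagonal [IsProbabilityMeasure P] [IsProbabilityMeasure Q]
    (hP : MemLp id 2 P) (hQ : MemLp id 2 Q)
    (b : OrthonormalBasis (Fin d) ℝ (EuclideanSpace ℝ (Fin d))) {a : Fin d → ℝ}
    (ha : ∀ k, 0 < a k) (c : Fin d → ℝ)
    (h : P.map (fun x => b.repr.symm (WithLp.toLp 2 fun k => a k * b.repr x k + c k)) = Q) :
    IsOptimalTransportMap P Q
      (fun x => b.repr.symm (WithLp.toLp 2 fun k => a k * b.repr x k + c k)) := by
  have coord {R : Measure (EuclideanSpace ℝ (Fin d))} (hR : MemLp id 2 R) (k : Fin d) :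
      MemLp (fun x => b.repr x k) 2 R := by
    simp_rw [b.repr_apply_apply]
    exact hR.const_inner (b k)
  have quad {R : Measure (EuclideanSpace ℝ (Fin d))} [IsProbabilityMeasure R] (hR : MemLp id 2 R)
      (u v w : Fin d → ℝ) :
      Integrable (fun x => ∑ k, (u k * b.repr x k ^ 2 + v k * b.repr x k + w k)) R :=
    integrable_finsetSum _ fun k _ => (((coord hR k).integrable_sq.const_mul _).add
      (((coord hR k).integrable (by norm_num)).const_mul _)).add (integrable_const _)
  have hn (x y : EuclideanSpace ℝ (Fin d)) :
      ‖x - y‖ ^ 2 = ∑ k, (b.repr x k - b.repr y k) ^ 2 := by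
    rw [← b.repr.norm_map, EuclideanSpace.real_norm_sq_eq]
    simp
  refine isOptimalTransportMap_of_potentials (by fun_prop) h
    (quad hP (fun k => 1 - a k) (fun k => -2 * c k) (fun _ => 0))
    (quad hQ (fun k => 1 - 1 / a k) (fun k => 2 * c k / a k) (fun k => - c k ^ 2 / a k))
    (fun x y => ?_) (fun x => ?_)
  · rw [hn, ← Finset.sum_add_distrib]
    refine Finset.sum_le_sum fun k _ => ?_
    have h1 : 0 ≤ (b.repr y k - a k * b.repr x k - c k) ^ 2 / a k :=
      div_nonneg (sq_nonneg _) (ha k).le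
    have h2 : (b.repr y k - a k * b.repr x k - c k) ^ 2 / a k = (b.repr x k - b.repr y k) ^ 2 -
        ((1 - a k) * b.repr x k ^ 2 + -2 * c k * b.repr x k + 0 +
          ((1 - 1 / a k) * b.repr y k ^ 2 + 2 * c k / a k * b.repr y k + - c k ^ 2 / a k)) := by
      have := (ha k).ne'
      field_simp
      ring
    linarith
  · rw [hn, ← Finset.sum_add_distrib]
    refine Finset.sum_congr rfl fun k _ => ?_
    have := (ha k).ne'
    simp only [LinearIsometryEquiv.apply_symm_apply]
    field_simp
    ring

theorem gaussianIn_map_affine (b : OrthonormalBasis (Fin d) ℝ (EuclideanSpace ℝ (Fin d)))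
    (m ν : Fin d → ℝ) {w l : Fin d → ℝ} (hw : ∀ k, 0 < w k) (hl : ∀ k, 0 < l k) :
    (gaussianIn b m w).map (fun x => b.repr.symm (WithLp.toLp 2 fun k =>
      √(l k / w k) * b.repr x k + (ν k - √(l k / w k) * m k))) = gaussianIn b ν l := by
  have h1 : (Measure.pi fun k => gaussianReal (ν k) (l k).toNNReal) =
      (Measure.pi fun k => gaussianReal (m k) (w k).toNNReal).map
        fun y k => √(l k / w k) * y k + (ν k - √(l k / w k) * m k) := by
    rw [Measure.pi_map_pi (f := fun k y => √(l k / w k) * y + (ν k - √(l k / w k) * m k))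
      (by fun_prop)]
    congr with k : 1
    have : (fun y => √(l k / w k) * y + (ν k - √(l k / w k) * m k)) =
      (fun y => y + (ν k - √(l k / w k) * m k)) ∘ (fun y => √(l k / w k) * y) := rfl
    rw [this, ← Measure.map_map (by fun_prop) (by fun_prop), gaussianReal_map_const_mul,
      gaussianReal_map_add_const]
    congr 1
    · ring
    · have hlw : 0 ≤ l k / w k := (div_pos (hl k) (hw k)).le
      ext
      simp [Real.coe_toNNReal _ (hl k).le, Real.coe_toNNReal _ (hw k).le, Real.sq_sqrt hlw,
        (hw k).ne']
  rw [gaussianIn, gaussianIn, h1]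
  repeat rw [Measure.map_map (by fun_prop) (by fun_prop)]
  congr 1
  ext x
  simp

/-- Rules out the identity fallback in `transportMap`. Uniqueness is not needed: the estimates below
use only that the chosen map is measurable and has the right push-forward. -/
theorem exists_isOptimalTransportMap {lmin lmax : ℝ} (hlmin : 0 < lmin)
    {S S' : Matrix (Fin d) (Fin d) ℝ} (hS : CovarianceIn lmin lmax S)
    (hS' : CovarianceIn lmin lmax S') (h : Commute S S') (μ μ' : EuclideanSpace ℝ (Fin d)) :
    ∃ T, IsOptimalTransportMap (multivariateGaussian μ S) (multivariateGaussian μ' S') T := by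
  obtain ⟨b, u, v, hu, hv, hu', hv'⟩ := exists_orthonormalBasis_of_commute hS hS' h
  have hu0 k : 0 < u k := hlmin.trans_le (hu' k).1
  have hv0 k : 0 < v k := hlmin.trans_le (hv' k).1
  refine ⟨_, isOptimalTransportMap_of_diagonal IsGaussian.memLp_two_id IsGaussian.memLp_two_id b
    (fun k => Real.sqrt_pos.2 (div_pos (hv0 k) (hu0 k)))
    (fun k => b.repr μ' k - √(v k / u k) * b.repr μ k) ?_⟩
  · rw [multivariateGaussian_eq_gaussianIn b μ hS.1.posSemidef (fun k => (hu0 k).le) hu,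
      multivariateGaussian_eq_gaussianIn b μ' hS'.1.posSemidef (fun k => (hv0 k).le) hv]
    exact gaussianIn_map_affine b _ _ hu0 hv0

theorem W2_map_le {S T : EuclideanSpace ℝ (Fin d) → EuclideanSpace ℝ (Fin d)}
    (hS : Measurable S) (hT : Measurable T) :
    W2 (P.map S) (P.map T) ≤ eLpNorm (S - T) 2 P := by
  refine (ENNReal.pow_le_pow_left_iff two_ne_zero).1 ((W2_map_sq_le hS hT).trans_eq ?_)
  rw [eLpNorm_eq_lintegral_rpow_enorm_toReal (by norm_num) (by norm_num),
    ← ENNReal.rpow_natCast _ 2, ← ENNReal.rpow_mul]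
  simp [edist_eq_enorm_sub]

theorem isOptimalTransportMap_transportMap (h : ∃ T, IsOptimalTransportMap P Q T) :
    IsOptimalTransportMap P Q (transportMap P Q) := by
  rw [transportMap, dif_pos h]
  exact h.choose_spec

variable {N : ℕ} {β : ℝ} {X : Fin N → Measure (EuclideanSpace ℝ (Fin d))}
  {ξ : Measure (EuclideanSpace ℝ (Fin d))}

theorem W2_toReal_le_radiusMax (X : Fin N → Measure (EuclideanSpace ℝ (Fin d))) (j : Fin N) :
    (W2 (X j) (Measure.dirac 0)).toReal ≤ radiusMax X :=
  le_ciSup (f := fun i => (W2 (X i) (Measure.dirac 0)).toReal) (Set.finite_range _).bddAbove j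

theorem radiusMax_nonneg (X : Fin N → Measure (EuclideanSpace ℝ (Fin d))) : 0 ≤ radiusMax X :=
  Real.iSup_nonneg fun _ => ENNReal.toReal_nonneg

theorem weight_nonneg (β : ℝ) (X : Fin N → Measure (EuclideanSpace ℝ (Fin d)))
    (ξ : Measure (EuclideanSpace ℝ (Fin d))) (j : Fin N) : 0 ≤ weight β X ξ j := by
  unfold weight
  positivity

theorem sum_weight (β : ℝ) (X : Fin N → Measure (EuclideanSpace ℝ (Fin d)))
    (ξ : Measure (EuclideanSpace ℝ (Fin d))) (i : Fin N) : ∑ j, weight β X ξ j = 1 := by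
  unfold weight
  rw [← Finset.sum_div]
  exact div_self (Finset.sum_pos (fun _ _ => Real.exp_pos _) ⟨i, Finset.mem_univ i⟩).ne'

/-- Only the `i`-th term of the partition function is kept. -/
theorem weight_le_exp (i j : Fin N) :
    weight β X ξ j ≤ Real.exp (-(β * ((W2 (X j) ξ).toReal ^ 2 - (W2 (X i) ξ).toReal ^ 2))) := by
  have : -(β * ((W2 (X j) ξ).toReal ^ 2 - (W2 (X i) ξ).toReal ^ 2)) =
    -β * (W2 (X j) ξ).toReal ^ 2 - -β * (W2 (X i) ξ).toReal ^ 2 := by ring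
  rw [this, Real.exp_sub, weight]
  refine div_le_div_of_nonneg_left (Real.exp_pos _).le (Real.exp_pos _) ?_
  exact Finset.single_le_sum (f := fun k => Real.exp (-β * (W2 (X k) ξ).toReal ^ 2))
    (fun _ _ => (Real.exp_pos _).le) (Finset.mem_univ i)

theorem eLpNorm_of_map_eq {T : EuclideanSpace ℝ (Fin d) → EuclideanSpace ℝ (Fin d)}
    [IsProbabilityMeasure Q] (hT : Measurable T) (h : P.map T = Q) :
    eLpNorm T 2 P = W2 Q (Measure.dirac 0) := by
  rw [W2_dirac_zero, ← h, eLpNorm_map_measure (by fun_prop) hT.aemeasurable]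
  rfl

/-- The measure `ξ` itself couples `Φ(ξ)` with `X_i`, and since the weights sum to one the
difference of the two maps is `∑ w_j (T_j - T_i)`. -/
theorem W2_Phi_le_of_weight_le [IsProbabilityMeasure ξ] [∀ j, IsProbabilityMeasure (X j)]
    (hX : ∀ j, MemLp id 2 (X j)) (hT : ∀ j, ∃ T, IsOptimalTransportMap ξ (X j) T) {i : Fin N}
    {ε : ℝ} (h : ∀ j, j ≠ i → weight β X ξ j ≤ ε) (hε : 0 ≤ ε) :
    W2 (Phi β X ξ) (X i) ≤ ENNReal.ofReal (2 * radiusMax X * (N * ε)) := by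
  have hT' j := isOptimalTransportMap_transportMap (hT j)
  set T := fun j => transportMap ξ (X j) with hTdef
  have hm j : Measurable (T j) := (hT' j).1
  have hnorm j : eLpNorm (T j) 2 ξ ≤ ENNReal.ofReal (radiusMax X) := by
    have hfin : W2 (X j) (Measure.dirac 0) ≠ ∞ := by
      rw [W2_dirac_zero]
      exact (hX j).eLpNorm_lt_top.ne
    rw [eLpNorm_of_map_eq (hm j) (hT' j).2.1, ← ENNReal.ofReal_toReal hfin]
    exact ENNReal.ofReal_le_ofReal (W2_toReal_le_radiusMax X j)
  have hsum : (fun x => ∑ j, weight β X ξ j • T j x) - T i =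
      ∑ j, weight β X ξ j • (T j - T i) := by
    ext1 x
    simp only [Pi.sub_apply, Finset.sum_apply, Pi.smul_apply, smul_sub, Finset.sum_sub_distrib,
      ← Finset.sum_smul, sum_weight β X ξ i, one_smul]
  have hterm j : eLpNorm (weight β X ξ j • (T j - T i)) 2 ξ ≤
      ENNReal.ofReal (ε * (2 * radiusMax X)) := by
    by_cases hj : j = i
    · subst hj
      simp
    · rw [eLpNorm_const_smul, ENNReal.ofReal_mul hε]
      refine mul_le_mul' ?_ ?_
      · rw [Real.enorm_of_nonneg (weight_nonneg β X ξ j)]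
        exact ENNReal.ofReal_le_ofReal (h j hj)
      · refine (eLpNorm_sub_le (hm j).aestronglyMeasurable (hm i).aestronglyMeasurable
          (by norm_num)).trans ((add_le_add (hnorm j) (hnorm i)).trans_eq ?_)
        rw [← ENNReal.ofReal_add (radiusMax_nonneg X) (radiusMax_nonneg X), two_mul]
  have hXi : X i = ξ.map (T i) := (hT' i).2.1.symm
  calc W2 (Phi β X ξ) (X i)
      ≤ eLpNorm ((fun x => ∑ j, weight β X ξ j • T j x) - T i) 2 ξ := by
        conv_lhs => rw [hXi]
        exact W2_map_le (Finset.measurable_sum _ fun j _ => 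
          show Measurable (weight β X ξ j • T j) from (hm j).const_smul _) (hm i)
    _ ≤ ∑ j, eLpNorm (weight β X ξ j • (T j - T i)) 2 ξ := by
        rw [hsum]
        exact eLpNorm_sum_le (fun j _ => (((hm j).sub (hm i)).const_smul _).aestronglyMeasurable)
          (by norm_num)
    _ ≤ ∑ _j : Fin N, ENNReal.ofReal (ε * (2 * radiusMax X)) :=
        Finset.sum_le_sum fun j _ => hterm j
    _ = ENNReal.ofReal (2 * radiusMax X * (N * ε)) := by
        rw [Finset.sum_const, Finset.card_univ, Fintype.card_fin, nsmul_eq_mul,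
          ← ENNReal.ofReal_natCast, ← ENNReal.ofReal_mul (by positivity)]
        congr 1
        ring

/-- With `D` the distance of means, `W₂(X_j, ξ) ≥ D - r` and `W₂(X_i, ξ) ≤ r`, so the difference of
squares is at least `D² - 2 D r`. The condition `r ≤ D` permits squaring. -/
theorem W2_Phi_le [IsProbabilityMeasure ξ] [∀ j, IsProbabilityMeasure (X j)] (hβ : 0 < β)
    (hξ : MemLp id 2 ξ) (hX : ∀ j, MemLp id 2 (X j))
    (hT : ∀ j, ∃ T, IsOptimalTransportMap ξ (X j) T) {i : Fin N} {r K : ℝ} (hr : 0 ≤ r)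
    (hi : W2 (X i) ξ ≤ ENNReal.ofReal r)
    (h : ∀ j, j ≠ i → r ≤ ‖∫ x, x ∂(X i) - ∫ x, x ∂(X j)‖ ∧
      K ≤ β * (‖∫ x, x ∂(X i) - ∫ x, x ∂(X j)‖ ^ 2 -
        2 * ‖∫ x, x ∂(X i) - ∫ x, x ∂(X j)‖ * r)) :
    W2 (Phi β X ξ) (X i) ≤ ENNReal.ofReal (2 * radiusMax X * (N * Real.exp (-K))) := by
  refine W2_Phi_le_of_weight_le hX hT (fun j hj => ?_) (Real.exp_pos _).le
  obtain ⟨h1, h2⟩ := h j hj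
  refine (weight_le_exp i j).trans (Real.exp_le_exp.2 (neg_le_neg (h2.trans ?_)))
  have hmean (k : Fin N) : ‖∫ x, x ∂(X k) - ∫ x, x ∂ξ‖ ≤ (W2 (X k) ξ).toReal :=
    (ENNReal.ofReal_le_iff_le_toReal (W2_lt_top (hX k) hξ).ne).1
      (ofReal_norm_sub_le_W2 ((hX k).integrable (by norm_num)) (hξ.integrable (by norm_num)))
  have hWi : (W2 (X i) ξ).toReal ≤ r := ENNReal.toReal_le_of_le_ofReal hr hi
  have htri := norm_sub_le_norm_sub_add_norm_sub (∫ x, x ∂(X i)) (∫ x, x ∂ξ) (∫ x, x ∂(X j))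
  rw [norm_sub_rev (∫ x, x ∂ξ)] at htri
  have hWj : ‖∫ x, x ∂(X i) - ∫ x, x ∂(X j)‖ - r ≤ (W2 (X j) ξ).toReal := by
    linarith [hmean i, hmean j]
  have h3 := pow_le_pow_left₀ (sub_nonneg.2 h1) hWj 2
  have h4 := pow_le_pow_left₀ ENNReal.toReal_nonneg hWi 2
  exact mul_le_mul_of_nonneg_left (by nlinarith) hβ.le

end Retrieval

/-! ### Retrieval of a separated Gaussian pattern -/

section GaussianRetrieval

variable {d N : ℕ} {lmin lmax β : ℝ}

theorem CovarianceIn.lmin_le_lmax {S : Matrix (Fin d) (Fin d) ℝ} (hS : CovarianceIn lmin lmax S)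
    (hd : 0 < d) : lmin ≤ lmax := by
  have := hS.2 (hS.1.isHermitian.eigenvalues_mem_spectrum_real ⟨0, hd⟩)
  exact this.1.trans this.2

theorem W2_dirac_zero_toReal_sq (μ : EuclideanSpace ℝ (Fin d)) {S : Matrix (Fin d) (Fin d) ℝ}
    (hS : S.PosSemidef) :
    (W2 (multivariateGaussian μ S) (Measure.dirac 0)).toReal ^ 2 = ‖μ‖ ^ 2 + S.trace := by
  have hm : MemLp id 2 (multivariateGaussian μ S) := IsGaussian.memLp_two_id
  have hk (k : Fin d) : MemLp (fun x => x k) 2 (multivariateGaussian μ S) := by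
    have := hm.const_inner (𝕜 := ℝ) (EuclideanSpace.basisFun (Fin d) ℝ k)
    simpa [PiLp.inner_apply] using this
  have h1 : ∫ x, ‖x‖ ^ 2 ∂(multivariateGaussian μ S) = ‖μ‖ ^ 2 + S.trace := by
    simp_rw [EuclideanSpace.real_norm_sq_eq]
    rw [integral_finsetSum _ fun k _ => (hk k).integrable_sq, Matrix.trace,
      ← Finset.sum_add_distrib]
    refine Finset.sum_congr rfl fun k _ => ?_
    have h2 : ∫ x, x k ∂(multivariateGaussian μ S) = μ k := by
      have := (EuclideanSpace.proj (𝕜 := ℝ) k).integral_comp_id_comm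
        (IsGaussian.integrable_id (μ := multivariateGaussian μ S))
      simpa using this
    have h3 := variance_eval_multivariateGaussian (μ := μ) hS (i := k)
    rw [variance_eq_sub (hk k)] at h3
    simp only [Pi.pow_apply, h2] at h3
    simp only [Matrix.diag_apply]
    linarith
  rw [W2_dirac_zero, ← h1, hm.eLpNorm_eq_integral_rpow_norm (by norm_num) (by norm_num),
    ENNReal.toReal_ofReal (by positivity), ← Real.rpow_natCast, ← Real.rpow_mul (by positivity)]
  norm_num

theorem norm_le_W2_dirac_zero (μ : EuclideanSpace ℝ (Fin d)) (S : Matrix (Fin d) (Fin d) ℝ) :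
    ‖μ‖ ≤ (W2 (multivariateGaussian μ S) (Measure.dirac 0)).toReal := by
  have hm : MemLp id 2 (multivariateGaussian μ S) := IsGaussian.memLp_two_id
  refine (ENNReal.ofReal_le_iff_le_toReal ?_).1 ?_
  · rw [W2_dirac_zero]
    exact hm.eLpNorm_lt_top.ne
  · have := ofReal_norm_sub_le_W2 (hm.integrable (by norm_num))
      (Q := Measure.dirac 0) (integrable_dirac (by simp))
    simpa using this

variable {mean : Fin N → EuclideanSpace ℝ (Fin d)} {S : Fin N → Matrix (Fin d) (Fin d) ℝ}
  {X : Fin N → Measure (EuclideanSpace ℝ (Fin d))} {i : Fin N} {m : EuclideanSpace ℝ (Fin d)}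
  {Om : Matrix (Fin d) (Fin d) ℝ} {ξ : Measure (EuclideanSpace ℝ (Fin d))}

theorem W2_Phi_multivariateGaussian_le (hlmin : 0 < lmin) (hβ : 0 < β)
    (hS : ∀ j, CovarianceIn lmin lmax (S j)) (hOm : CovarianceIn lmin lmax Om)
    (hc : ∀ j, Commute (S j) Om) (hX : ∀ j, X j = multivariateGaussian (mean j) (S j))
    (hξ : ξ = multivariateGaussian m Om) {r K : ℝ} (hr : 0 ≤ r)
    (hi : W2 (X i) ξ ≤ ENNReal.ofReal r)
    (h : ∀ j, j ≠ i → r ≤ ‖mean i - mean j‖ ∧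
      K ≤ β * (‖mean i - mean j‖ ^ 2 - 2 * ‖mean i - mean j‖ * r)) :
    W2 (Phi β X ξ) (X i) ≤ ENNReal.ofReal (2 * radiusMax X * (N * Real.exp (-K))) := by
  obtain rfl : X = fun j => multivariateGaussian (mean j) (S j) := funext hX
  subst hξ
  refine W2_Phi_le hβ IsGaussian.memLp_two_id (fun j => IsGaussian.memLp_two_id)
    (fun j => exists_isOptimalTransportMap hlmin hOm (hS j) (hc j).symm _ _) hr hi fun j hj => ?_
  simpa using h j hj

/-- One-step retrieval at a separated pattern. -/
theorem W2_Phi_le_of_separatedAt (hlmin : 0 < lmin) (hβ : 0 < β)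
    (hS : ∀ j, CovarianceIn lmin lmax (S j)) (hOm : CovarianceIn lmin lmax Om)
    (hSS : ∀ j k, Commute (S j) (S k)) (hc : ∀ j, Commute (S j) Om)
    (hX : ∀ j, X j = multivariateGaussian (mean j) (S j)) (hξ : ξ = multivariateGaussian m Om)
    (hsep : SeparatedAt β lmin lmax X i) (htemp : TemperatureConstraint β lmin lmax X)
    (hN : 144 * β * radiusMax X ^ 2 < N) (hi : W2 (X i) ξ ≤ ENNReal.ofReal (1 / √(β * N))) :
    W2 (Phi β X ξ) (X i) ≤ ENNReal.ofReal (3 / √(β * N)) := by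
  have hN1 : (1 : ℝ) ≤ N := by exact_mod_cast (Nat.one_le_iff_ne_zero.2 fun h => by
    subst h; exact i.elim0)
  have hβN : 0 < β * N := by positivity
  set C := sizeConst lmin lmax X with hC
  set M := radiusMax X with hM
  have hM0 : 0 ≤ M := radiusMax_nonneg X
  set t := (N : ℝ) ^ 3 * β * C with ht
  have ht2 : Real.exp 2 < t := by
    have : Real.exp 2 < C * (N : ℝ) ^ 3 * β := htemp
    rw [ht]
    linarith
  have ht0 : 0 < t := (Real.exp_pos 2).trans ht2
  have hlog : 2 < Real.log t := (Real.lt_log_iff_exp_lt ht0).2 ht2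
  set r := 1 / √(β * N) with hr
  have hr0 : 0 < r := by positivity
  have hr2 : r ^ 2 = 1 / (β * N) := by
    rw [hr, div_pow, Real.sq_sqrt hβN.le, one_pow]
  have hr2' : β * r ^ 2 ≤ 1 := by
    rw [hr2, mul_one_div, div_le_one hβN]
    nlinarith
  have hMj (j : Fin N) : ‖mean j‖ ≤ M := by
    refine (norm_le_W2_dirac_zero (mean j) (S j)).trans ?_
    rw [← hX j]
    exact W2_toReal_le_radiusMax X j
  -- The square is `β M² / N`, and `144 = 12²`.
  have hMr : M * β * r ≤ 1 / 12 := by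
    have : (M * β * r) ^ 2 ≤ (1 / 12) ^ 2 := by
      rw [mul_pow, mul_pow, hr2, mul_one_div, div_le_iff₀ hβN]
      nlinarith
    exact le_of_sq_le_sq this (by norm_num)
  have hD (j : Fin N) (hj : j ≠ i) : 4 * Real.log t ≤ β * ‖mean i - mean j‖ ^ 2 := by
    have h0 := (neg_log_innerL2_bounds hlmin (hS i) (hS j) (hSS i j) (mean i) (mean j)).1
    rw [← hX i, ← hX j] at h0
    have h1 := (hsep j hj).trans h0
    have h2 : 1 / (β * lmin) * Real.log t ≤ ‖mean i - mean j‖ ^ 2 / (4 * lmin) := by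
      rw [← hC, ← ht] at h1
      linarith
    rw [one_div_mul_eq_div, div_le_div_iff₀ (by positivity) (by positivity)] at h2
    nlinarith
  -- The exponent is at least `4 log t - 4 M β r ≥ 4 log t - 1/3`, so `log t / 2` leaves ample room;
  -- it is chosen because `1/√t` is all that the final comparison needs.
  have hK : W2 (Phi β X ξ) (X i) ≤ ENNReal.ofReal (2 * M * (N * Real.exp (-(Real.log t / 2)))) := by
    refine W2_Phi_multivariateGaussian_le hlmin hβ hS hOm hc hX hξ hr0.le hi fun j hj => ⟨?_, ?_⟩
    · refine le_of_sq_le_sq ?_ (norm_nonneg _)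
      have := hD j hj
      exact le_of_mul_le_mul_left (by linarith) hβ
    · have h1 : ‖mean i - mean j‖ ≤ 2 * M := (norm_sub_le _ _).trans (by linarith [hMj i, hMj j])
      have h2 : ‖mean i - mean j‖ * (β * r) ≤ 2 * M * (β * r) :=
        mul_le_mul_of_nonneg_right h1 (by positivity)
      have := hD j hj
      nlinarith
  refine hK.trans (ENNReal.ofReal_le_ofReal ?_)
  have hexp : Real.exp (-(Real.log t / 2)) = (√t)⁻¹ := by
    rw [Real.exp_neg, Real.exp_half, Real.exp_log ht0]
  -- After squaring this is `4 M² N² ≤ C N²`, because `t r² = C N²`.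
  have h1 : 2 * M * N ≤ √t * r := by
    refine le_of_sq_le_sq ?_ (by positivity)
    rw [mul_pow √t, Real.sq_sqrt ht0.le, hr2, ht]
    have h2 : (N : ℝ) ^ 3 * β * C * (1 / (β * N)) = C * N ^ 2 := by
      field_simp
    have h3 : 4 * M ^ 2 ≤ C := by
      rw [hC, sizeConst]
      have : 0 ≤ 2 * (d : ℝ) * (lmax + lmin) := by
        -- In dimension zero there are no eigenvalues to force `0 < lmax`, but then the term
        -- vanishes.
        rcases Nat.eq_zero_or_pos d with hd | hd
        · simp [hd]
        · have := hOm.lmin_le_lmax hd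
          have : 0 < lmax := by linarith
          positivity
      linarith
    rw [h2]
    nlinarith [sq_nonneg (N : ℝ)]
  rw [hexp, ← mul_assoc, ← div_eq_mul_inv, div_le_iff₀ (by positivity)]
  have h3 : 3 / √(β * N) = 3 * r := by rw [hr]; ring
  rw [h3]
  nlinarith [mul_pos (Real.sqrt_pos.2 ht0) hr0]

end GaussianRetrieval

/-! ### Concentration on the sphere and random means -/

section Sampling

variable {d : ℕ}

open scoped Pointwise in
-- The cone over the cap fits in a ball of radius `exp(-t²/2)` centred at `t v`: its points satisfy
-- `‖s u - t v‖² ≤ s² - 2 s t² + t² ≤ 1 - t²`. Comparing volumes gives the `d`-th power of the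
-- radius.
theorem toSphere_cap_le {v : EuclideanSpace ℝ (Fin d)} (hv : ‖v‖ = 1) {t : ℝ} (ht0 : 0 ≤ t)
    (ht : 2 * t ^ 2 ≤ 1) :
    (volume : Measure (EuclideanSpace ℝ (Fin d))).toSphere {u | t < inner ℝ u.1 v} ≤
      ENNReal.ofReal (Real.exp (-(d * t ^ 2 / 2))) *
        (volume : Measure (EuclideanSpace ℝ (Fin d))).toSphere Set.univ := by
  have hmeas : MeasurableSet
      {u : Metric.sphere (0 : EuclideanSpace ℝ (Fin d)) 1 | t < inner ℝ u.1 v} :=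
    measurableSet_lt measurable_const (by fun_prop)
  have hsub : Set.Ioo (0 : ℝ) 1 • ((↑) ''
      {u : Metric.sphere (0 : EuclideanSpace ℝ (Fin d)) 1 | t < inner ℝ u.1 v}) ⊆
      Metric.closedBall (t • v) (Real.exp (-(t ^ 2 / 2))) := by
    rintro _ ⟨s, ⟨hs0, hs1⟩, _, ⟨u, hu, rfl⟩, rfl⟩
    have hu1 : ‖(u : EuclideanSpace ℝ (Fin d))‖ = 1 := by simp
    have hu' : t < inner ℝ u.1 v := hu
    rw [mem_closedBall_iff_norm]
    refine le_of_sq_le_sq ?_ (Real.exp_pos _).le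
    change ‖s • u.1 - t • v‖ ^ 2 ≤ _
    rw [norm_sub_sq_real, norm_smul, norm_smul, hu1, hv, real_inner_smul_left,
      real_inner_smul_right, ← Real.exp_nat_mul, mul_one, mul_one, Real.norm_eq_abs,
      Real.norm_eq_abs, sq_abs, sq_abs]
    have h1 : -t ^ 2 + 1 ≤ Real.exp (-t ^ 2) := Real.add_one_le_exp _
    have h2 : ((2 : ℕ) : ℝ) * -(t ^ 2 / 2) = -t ^ 2 := by push_cast; ring
    have h3 : s * t * t ≤ s * t * inner ℝ u.1 v :=
      mul_le_mul_of_nonneg_left hu'.le (by positivity)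
    rw [h2]
    -- The gap `1 - t² - (s² - 2 s t² + t²)` equals `(1 - s)(1 + s - 2 t²)`; nonnegativity of the
    -- second factor uses `2 t² ≤ 1`.
    nlinarith [mul_nonneg (sub_nonneg.2 hs1.le) (by linarith : 0 ≤ 1 + s - 2 * t ^ 2)]
  rw [Measure.toSphere_apply' _ hmeas, Measure.toSphere_apply_univ, ← mul_assoc,
    mul_comm (ENNReal.ofReal _), mul_assoc]
  refine mul_le_mul_right ((measure_mono hsub).trans_eq ?_) _
  rw [Measure.addHaar_closedBall _ _ (Real.exp_pos _).le, ← Real.exp_nat_mul]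
  congr 3
  simp
  ring

theorem uniformSphere_cap_le {ρ : ℝ} (hρ : 0 < ρ) {y : EuclideanSpace ℝ (Fin d)} (hy : ‖y‖ = ρ)
    {t : ℝ} (ht0 : 0 ≤ t) (ht : 2 * t ^ 2 ≤ 1) :
    uniformSphere d ρ {x | t * ρ ^ 2 < inner ℝ x y} ≤
      ENNReal.ofReal (Real.exp (-(d * t ^ 2 / 2))) := by
  have hv : ‖ρ⁻¹ • y‖ = 1 := by
    rw [norm_smul, hy, norm_inv, Real.norm_of_nonneg hρ.le, inv_mul_cancel₀ hρ.ne']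
  rw [uniformSphere, Measure.map_apply (by fun_prop)
    (measurableSet_lt measurable_const (by fun_prop)), Measure.smul_apply, smul_eq_mul]
  have hset : (fun u : Metric.sphere (0 : EuclideanSpace ℝ (Fin d)) 1 => ρ • u.1) ⁻¹'
      {x | t * ρ ^ 2 < inner ℝ x y} = {u | t < inner ℝ u.1 (ρ⁻¹ • y)} := by
    ext u
    simp only [Set.mem_preimage, Set.mem_ofPred_eq, real_inner_smul_left, real_inner_smul_right]
    rw [inv_mul_eq_div, lt_div_iff₀ hρ, sq, ← mul_assoc, mul_comm ρ (inner ℝ _ _),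
      mul_lt_mul_iff_left₀ hρ]
  rw [hset]
  refine (mul_le_mul_right (toSphere_cap_le hv ht0 ht) _).trans ?_
  rw [mul_left_comm]
  exact mul_le_of_le_one_right' (ENNReal.inv_mul_le_one _)

theorem ae_norm_eq_uniformSphere {ρ : ℝ} (hρ : 0 ≤ ρ) : ∀ᵐ x ∂(uniformSphere d ρ), ‖x‖ = ρ := by
  rw [uniformSphere, ae_map_iff (by fun_prop) (measurableSet_eq_fun (by fun_prop) (by fun_prop))]
  refine ae_of_all _ fun u => ?_
  rw [norm_smul, Real.norm_of_nonneg hρ]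
  simp

theorem measurableSet_spectrumPolytope (d : ℕ) (R lmin lmax : ℝ) :
    MeasurableSet (spectrumPolytope d R lmin lmax) := by
  refine IsClosed.measurableSet ?_
  simp only [spectrumPolytope, Set.ofPred_and, Set.ofPred_forall]
  refine (isClosed_eq (by fun_prop) (by fun_prop)).inter (isClosed_iInter fun k => ?_)
  exact (isClosed_le (by fun_prop) (by fun_prop)).inter (isClosed_le (by fun_prop) (by fun_prop))

theorem ae_mem_spectrumPolytope (d : ℕ) (R lmin lmax : ℝ) :
    ∀ᵐ l ∂(uniformPolytope d R lmin lmax), l ∈ spectrumPolytope d R lmin lmax :=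
  ae_cond_mem (measurableSet_spectrumPolytope d R lmin lmax)

theorem measure_inner_gt_le {Ω : Type*} [MeasurableSpace Ω] {P : Measure Ω}
    [IsProbabilityMeasure P] {ρ : ℝ} (hρ : 0 < ρ) {Y Z : Ω → EuclideanSpace ℝ (Fin d)}
    (hY : HasLaw Y (uniformSphere d ρ) P) (hZ : HasLaw Z (uniformSphere d ρ) P)
    (h : IndepFun Y Z P) {t : ℝ} (ht0 : 0 ≤ t) (ht : 2 * t ^ 2 ≤ 1) :
    P {ω | t * ρ ^ 2 < inner ℝ (Y ω) (Z ω)} ≤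
      ENNReal.ofReal (Real.exp (-(d * t ^ 2 / 2))) := by
  -- Read off from the law: for `d = 0` the sphere is empty and `uniformSphere` is the zero measure.
  have hprob : IsProbabilityMeasure (uniformSphere d ρ) := hY.isProbabilityMeasure_iff.1 ‹_›
  have hlaw : P.map (fun ω => (Y ω, Z ω)) = (uniformSphere d ρ).prod (uniformSphere d ρ) := by
    rw [(indepFun_iff_map_prod_eq_prod_map_map hY.aemeasurable hZ.aemeasurable).1 h, hY.map_eq,
      hZ.map_eq]
  have hm : MeasurableSet {z : EuclideanSpace ℝ (Fin d) × EuclideanSpace ℝ (Fin d) |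
      t * ρ ^ 2 < inner ℝ z.1 z.2} :=
    measurableSet_lt measurable_const (by fun_prop)
  have h1 : P {ω | t * ρ ^ 2 < inner ℝ (Y ω) (Z ω)} =
      (uniformSphere d ρ).prod (uniformSphere d ρ) {z | t * ρ ^ 2 < inner ℝ z.1 z.2} := by
    rw [← hlaw, Measure.map_apply_of_aemeasurable (hY.aemeasurable.prodMk hZ.aemeasurable) hm]
    rfl
  rw [h1, Measure.prod_apply_symm hm]
  calc _ ≤ ∫⁻ _y, ENNReal.ofReal (Real.exp (-(d * t ^ 2 / 2))) ∂(uniformSphere d ρ) := by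
        refine lintegral_mono_ae ?_
        filter_upwards [ae_norm_eq_uniformSphere hρ.le] with y hy
        exact uniformSphere_cap_le hρ hy ht0 ht
    _ = _ := by simp

/-- With high probability the sampled spectra lie in the polytope, and the means lie on the sphere
and have pairwise small correlations. -/
theorem exists_measurableSet_separated {Ω : Type*} [MeasurableSpace Ω] {P : Measure Ω}
    [IsProbabilityMeasure P] {N : ℕ} {R lmin lmax : ℝ} (hR : 0 < R)
    {mean spec : Fin N → Ω → EuclideanSpace ℝ (Fin d)}
    (h : IsSample R lmin lmax P mean spec) {t : ℝ} (ht0 : 0 ≤ t) (ht : 2 * t ^ 2 ≤ 1) {p : ℝ}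
    (hp : N ^ 2 * Real.exp (-(d * t ^ 2 / 2)) ≤ p) :
    ∃ A : Set Ω, MeasurableSet A ∧ ENNReal.ofReal (1 - p) ≤ P A ∧ ∀ ω ∈ A,
      (∀ i, spec i ω ∈ spectrumPolytope d R lmin lmax) ∧ (∀ i, ‖mean i ω‖ = R / √2) ∧
      ∀ i j, i ≠ j → inner ℝ (mean i ω) (mean j ω) ≤ t * (R / √2) ^ 2 := by
  have hρ : 0 < R / √2 := by positivity
  -- All `N²` ordered pairs are counted; the diagonal ones contribute the empty set.
  set B : Set Ω := ⋃ q : Fin N × Fin N,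
    {ω | q.1 ≠ q.2 ∧ t * (R / √2) ^ 2 < inner ℝ (mean q.1 ω) (mean q.2 ω)} with hB
  set Z : Set Ω := {ω | ¬ ((∀ i, spec i ω ∈ spectrumPolytope d R lmin lmax) ∧
    ∀ i, ‖mean i ω‖ = R / √2)} with hZ
  have hZ0 : P Z = 0 := by
    have h1 : ∀ᵐ ω ∂P, (∀ i, spec i ω ∈ spectrumPolytope d R lmin lmax) ∧
        ∀ i, ‖mean i ω‖ = R / √2 := by
      refine (ae_all_iff.2 fun i => ?_).and (ae_all_iff.2 fun i => ?_)
      · exact ae_of_ae_map (h.spec_law i).aemeasurable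
          ((h.spec_law i).map_eq ▸ ae_mem_spectrumPolytope d R lmin lmax)
      · exact ae_of_ae_map (h.mean_law i).aemeasurable
          ((h.mean_law i).map_eq ▸ ae_norm_eq_uniformSphere hρ.le)
    exact ae_iff.1 h1
  have hBp : P B ≤ ENNReal.ofReal p := by
    refine (measure_iUnion_le _).trans ?_
    rw [tsum_fintype]
    refine (Finset.sum_le_sum (g := fun _ => ENNReal.ofReal (Real.exp (-(d * t ^ 2 / 2))))
      fun q _ => ?_).trans ?_
    · by_cases hq : q.1 = q.2
      · simp [hq]
      · refine (measure_mono (fun ω hω => hω.2)).trans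
          (measure_inner_gt_le hρ (h.mean_law q.1) (h.mean_law q.2) ?_ ht0 ht)
        exact h.indep.indepFun (i := Sum.inl q.1) (j := Sum.inl q.2) (by simpa using hq)
    · rw [Finset.sum_const, Finset.card_univ, Fintype.card_prod, Fintype.card_fin, nsmul_eq_mul,
        ← ENNReal.ofReal_natCast, ← ENNReal.ofReal_mul (by positivity)]
      refine ENNReal.ofReal_le_ofReal (le_of_eq_of_le ?_ hp)
      push_cast
      ring
  have hp0 : 0 ≤ p := le_trans (by positivity) hp
  -- The samples are only almost everywhere measurable, so the bad set is replaced by a measurable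
  -- hull of the same measure.
  refine ⟨(toMeasurable P (Z ∪ B))ᶜ, (measurableSet_toMeasurable _ _).compl, ?_, fun ω hω => ?_⟩
  · rw [prob_compl_eq_one_sub (measurableSet_toMeasurable _ _), measure_toMeasurable,
      ENNReal.ofReal_sub _ hp0, ENNReal.ofReal_one]
    refine tsub_le_tsub_left ((measure_union_le _ _).trans ?_) _
    rwa [hZ0, zero_add]
  · have hω' : ω ∉ Z ∪ B := fun hmem => hω (subset_toMeasurable _ _ hmem)
    rw [Set.mem_union, not_or] at hω'
    obtain ⟨h1, h2⟩ := hω'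
    have h1' := not_not.1 h1
    refine ⟨h1'.1, h1'.2, fun i j hij => not_lt.1 fun hlt => h2 ?_⟩
    exact Set.mem_iUnion.2 ⟨(i, j), hij, hlt⟩

end Sampling

/-! ### Covariances with a prescribed common eigenbasis -/

section SampledCovariance

variable {d : ℕ} {U : Matrix (Fin d) (Fin d) ℝ}

theorem covOf_mul_covOf (hU : U ∈ Matrix.orthogonalGroup (Fin d) ℝ)
    (l l' : EuclideanSpace ℝ (Fin d)) :
    covOf U l * covOf U l' = U * Matrix.diagonal (fun k => l k * l' k) * U.transpose := by
  have h : U.transpose * U = 1 := (Matrix.mem_orthogonalGroup_iff' _ _).1 hU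
  rw [← Matrix.diagonal_mul_diagonal]
  calc _ = U * Matrix.diagonal (fun k => l k) * (U.transpose * U) *
        Matrix.diagonal (fun k => l' k) * U.transpose := by
        simp only [covOf, Matrix.mul_assoc]
    _ = _ := by rw [h]; simp only [Matrix.mul_assoc, Matrix.one_mul]

theorem commute_covOf (hU : U ∈ Matrix.orthogonalGroup (Fin d) ℝ)
    (l l' : EuclideanSpace ℝ (Fin d)) : Commute (covOf U l) (covOf U l') := by
  rw [commute_iff_eq, covOf_mul_covOf hU, covOf_mul_covOf hU]
  simp_rw [mul_comm]

theorem trace_covOf (hU : U ∈ Matrix.orthogonalGroup (Fin d) ℝ) (l : EuclideanSpace ℝ (Fin d)) :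
    (covOf U l).trace = ∑ k, l k := by
  have h : U.transpose * U = 1 := (Matrix.mem_orthogonalGroup_iff' _ _).1 hU
  rw [covOf, Matrix.trace_mul_comm, ← Matrix.mul_assoc, h, Matrix.one_mul, Matrix.trace_diagonal]

theorem covarianceIn_covOf (hU : U ∈ Matrix.orthogonalGroup (Fin d) ℝ) {lmin lmax : ℝ}
    (hlmin : 0 < lmin) {l : EuclideanSpace ℝ (Fin d)} (hl : ∀ k, lmin ≤ l k ∧ l k ≤ lmax) :
    CovarianceIn lmin lmax (covOf U l) := by
  have h : U.transpose * U = 1 := (Matrix.mem_orthogonalGroup_iff' _ _).1 hU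
  have h' : U * U.transpose = 1 := (Matrix.mem_orthogonalGroup_iff _ _).1 hU
  constructor
  · have h1 : (Matrix.diagonal fun k => l k).PosDef :=
      Matrix.PosDef.diagonal fun k => hlmin.trans_le (hl k).1
    have h2 := h1.mul_mul_conjTranspose_same (B := U) (Matrix.vecMul_injective_of_isUnit
      (IsUnit.of_mul_eq_one _ h'))
    rwa [Matrix.conjTranspose_eq_transpose_of_trivial] at h2
  · have h3 := spectrum.units_conjugate (R := ℝ) (a := Matrix.diagonal fun k => l k)
      (u := ⟨U, U.transpose, h', h⟩)
    have h4 : spectrum ℝ (covOf U l) = Set.range fun k => l k := by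
      rw [← spectrum_diagonal, ← h3]
      rfl
    rw [h4]
    rintro _ ⟨k, rfl⟩
    exact hl k

end SampledCovariance

/-! ### Separation, temperature and retrieval in high dimension -/

section HighDimension

variable {d N : ℕ} {lmin lmax β α : ℝ} {mean : Fin N → EuclideanSpace ℝ (Fin d)}
  {S : Fin N → Matrix (Fin d) (Fin d) ℝ} {X : Fin N → Measure (EuclideanSpace ℝ (Fin d))}

theorem sizeConst_bounds (hM : radiusMax X ^ 2 ≤ d * (lmax + lmin)) :
    2 * d * (lmax + lmin) ≤ sizeConst lmin lmax X ∧
      sizeConst lmin lmax X ≤ 6 * d * (lmax + lmin) := by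
  unfold sizeConst
  constructor
  · nlinarith [sq_nonneg (radiusMax X)]
  · linarith

/-- Already `C β ≥ 4 d λ_min β ≥ 12 d α ≥ 12 > e²`, whatever `N ≥ 1` is. -/
theorem temperatureConstraint_of_large (hα0 : 0 < α) (hα1 : α < 1) (hlmin : 0 < lmin)
    (hlmax : lmin < lmax) (hβ : 3 * α < β * lmin) (hd : 1 ≤ d * α) (hN : 1 ≤ N)
    (hM : radiusMax X ^ 2 ≤ d * (lmax + lmin)) : TemperatureConstraint β lmin lmax X := by
  have hd0 : 0 < d := Nat.pos_of_ne_zero fun h => by simp [h] at hd; linarith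
  have hβ0 : 0 < β := pos_of_mul_pos_left (by linarith) hlmin.le
  have hN1 : (1 : ℝ) ≤ (N : ℝ) ^ 3 := one_le_pow₀ (by exact_mod_cast hN)
  have hC := (sizeConst_bounds hM).1
  have hdr : (0 : ℝ) < d := by exact_mod_cast hd0
  have h1 : 12 ≤ 2 * d * (lmax + lmin) * β := by
    have h2 : (d : ℝ) * (3 * α) ≤ d * (β * lmin) := mul_le_mul_of_nonneg_left hβ.le hdr.le
    have h3 : (d : ℝ) * β * lmin ≤ d * β * lmax := by gcongr
    nlinarith
  have h2 : 12 ≤ sizeConst lmin lmax X * β := h1.trans (mul_le_mul_of_nonneg_right hC hβ0.le)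
  have h3 : Real.exp 2 < 12 := by
    have := Real.exp_one_lt_d9
    have h4 : Real.exp 2 = Real.exp 1 * Real.exp 1 := by rw [← Real.exp_add]; norm_num
    nlinarith [Real.exp_pos 1]
  calc Real.exp 2 < 12 := h3
    _ ≤ sizeConst lmin lmax X * β := h2
    _ ≤ sizeConst lmin lmax X * β * (N : ℝ) ^ 3 := le_mul_of_one_le_right (by linarith) hN1
    _ = _ := by ring

/-- The surplus `d α / 8` of the mean term over the log-determinant loss is split evenly: `d α / 16`
pays for `log N³` and `d α / 16` for `log (β C)`, each after division by `s = β λ_min`. -/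
theorem separatedAt_of_large (hα0 : 0 < α) (hα1 : α < 1) (hlmin : 0 < lmin)
    (hlmax : lmin < lmax) (hα : α = 1 - 2 * Real.log (lmax / lmin)) (hβ : 3 * α < β * lmin)
    (hd : 2048 * (lmax / lmin + 1) ≤ d * α ^ 3) (hN : 1 ≤ N)
    (hNle : (N : ℝ) ≤ Real.exp (d * α ^ 2 / 16)) (hM : radiusMax X ^ 2 ≤ d * (lmax + lmin))
    (hS : ∀ j, CovarianceIn lmin lmax (S j)) (hSS : ∀ j k, Commute (S j) (S k))
    (hX : ∀ j, X j = multivariateGaussian (mean j) (S j))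
    (hD : ∀ i j, i ≠ j → d * (lmax + lmin) * (1 - α / 2) ≤ ‖mean i - mean j‖ ^ 2) (i : Fin N) :
    SeparatedAt β lmin lmax X i := by
  intro j hj
  have hlmax0 : 0 < lmax := hlmin.trans hlmax
  have hγ : 0 < lmax / lmin := by positivity
  have hd0 : 0 < d := Nat.pos_of_ne_zero fun h => by simp [h] at hd; linarith
  have hdr : (0 : ℝ) < d := by exact_mod_cast hd0
  have hβ0 : 0 < β := pos_of_mul_pos_left (by linarith) hlmin.le
  have hN1 : (1 : ℝ) ≤ N := by exact_mod_cast hN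
  obtain ⟨hC1, hC2⟩ := sizeConst_bounds hM
  set C := sizeConst lmin lmax X
  set s := β * lmin with hs
  have hs0 : 0 < s := by positivity
  have hC0 : 0 < C := lt_of_lt_of_le (by positivity) hC1
  have hinner := (neg_log_innerL2_bounds hlmin (hS i) (hS j) (hSS i j) (mean i) (mean j)).2
  rw [← hX i, ← hX j] at hinner
  refine le_trans ?_ hinner
  have hlog1 : Real.log (4 * Real.pi * lmax) =
      Real.log (4 * Real.pi * lmin) + (1 - α) / 2 := by
    have : 4 * Real.pi * lmax = 4 * Real.pi * lmin * (lmax / lmin) := by field_simp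
    rw [this, Real.log_mul (by positivity) hγ.ne', hα]
    ring
  have hmean : d / 4 * (1 - α / 2) ≤ ‖mean i - mean j‖ ^ 2 / (4 * lmax) := by
    rw [le_div_iff₀ (by positivity)]
    refine le_trans ?_ (hD i j hj.symm)
    have : 0 ≤ d * lmin * (1 - α / 2) := by
      have : 0 < 1 - α / 2 := by linarith
      positivity
    nlinarith
  have hlogN : Real.log ((N : ℝ) ^ 3) ≤ s * (d * α / 16) := by
    rw [Real.log_pow]
    have h1 : Real.log N ≤ d * α ^ 2 / 16 := (Real.log_le_iff_le_exp (by linarith)).2 hNle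
    have h2 : 3 * α * (d * α / 16) ≤ s * (d * α / 16) := by gcongr
    push_cast
    nlinarith
  have hlogC : Real.log (β * C) ≤ s * (d * α / 16) := by
    -- Comparison with a square lets `log x ≤ x` absorb the logarithm uniformly in `β`. It amounts
    -- to `6 · 32² (γ + 1) ≤ s d α²`; as `s > 3α`, this explains `2048 = 6 · 32² / 3`.
    have h1 : β * C ≤ (s * (d * α / 32)) ^ 2 := by
      have h2 : β * C ≤ 6 * (lmax / lmin + 1) * s * d := by
        calc β * C ≤ β * (6 * d * (lmax + lmin)) := by gcongr
          _ = _ := by rw [hs]; field_simp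
      refine h2.trans ?_
      have h3 : 6144 * (lmax / lmin + 1) ≤ s * d * α ^ 2 := by
        have : 3 * α * (d * α ^ 2) ≤ s * (d * α ^ 2) := by gcongr
        nlinarith
      have h4 : 6144 * (lmax / lmin + 1) * (s * d) ≤ s * d * α ^ 2 * (s * d) := by gcongr
      nlinarith
    have h5 := Real.log_le_log (by positivity) h1
    rw [Real.log_pow] at h5
    have h6 : Real.log (s * (d * α / 32)) ≤ s * (d * α / 32) :=
      (Real.log_le_sub_one_of_pos (by positivity)).trans (by linarith)
    push_cast at h5
    linarith
  have hlog : 1 / s * Real.log ((N : ℝ) ^ 3 * β * C) ≤ d * α / 8 := by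
    rw [mul_assoc, Real.log_mul (by positivity) (by positivity), one_div_mul_eq_div,
      div_le_iff₀ hs0]
    linarith
  rw [hlog1]
  linarith

/-- The means are at squared distance at least `d λ_min`, so the weights decay like `exp(-β λ_min d
/ 2)`. This beats both `N³` and the polynomial factor in `β d`, uniformly in `β`. -/
theorem W2_Phi_le_of_large (hα0 : 0 < α) (hα1 : α < 1) (hlmin : 0 < lmin)
    (hlmax : lmin < lmax) (hβ : 3 * α < β * lmin)
    (hd : 2048 * (lmax / lmin + 1) ≤ d * α ^ 3) (hN : 1 ≤ N)
    (hNle : (N : ℝ) ≤ Real.exp (d * α ^ 2 / 16)) (hM : radiusMax X ^ 2 ≤ d * (lmax + lmin))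
    (hS : ∀ j, CovarianceIn lmin lmax (S j))
    (hX : ∀ j, X j = multivariateGaussian (mean j) (S j))
    (hD : ∀ i j, i ≠ j → d * (lmax + lmin) * (1 - α / 2) ≤ ‖mean i - mean j‖ ^ 2) (i : Fin N)
    {m : EuclideanSpace ℝ (Fin d)} {Om : Matrix (Fin d) (Fin d) ℝ}
    {ξ : Measure (EuclideanSpace ℝ (Fin d))} (hOm : CovarianceIn lmin lmax Om)
    (hc : ∀ j, Commute (S j) Om) (hξ : ξ = multivariateGaussian m Om)
    (hi : W2 (X i) ξ ≤ ENNReal.ofReal (1 / √(β * N))) :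
    W2 (Phi β X ξ) (X i) ≤ ENNReal.ofReal (3 / √(β * N)) := by
  have hlmax0 : 0 < lmax := hlmin.trans hlmax
  have hγ : 1 < lmax / lmin := (one_lt_div hlmin).2 hlmax
  have hd0 : 0 < d := Nat.pos_of_ne_zero fun h => by simp [h] at hd; linarith
  have hdr : (0 : ℝ) < d := by exact_mod_cast hd0
  have hβ0 : 0 < β := pos_of_mul_pos_left (by linarith) hlmin.le
  have hN1 : (1 : ℝ) ≤ N := by exact_mod_cast hN
  have hβN : 0 < β * N := by positivity
  set s := β * lmin with hs
  have hs0 : 0 < s := by positivity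
  have hα2 : α ^ 2 ≤ 1 := by nlinarith
  have hdα : 2048 * (lmax / lmin + 1) ≤ d * α := by
    have : d * α * α ^ 2 ≤ d * α * 1 := by gcongr
    nlinarith
  set M := radiusMax X with hMdef
  have hM0 : 0 ≤ M := radiusMax_nonneg X
  set r := 1 / √(β * N) with hr
  have hr0 : 0 < r := by positivity
  have hr2 : r ^ 2 = 1 / (β * N) := by
    rw [hr, div_pow, Real.sq_sqrt hβN.le, one_pow]
  have hD' (j : Fin N) (hj : j ≠ i) : d * lmin ≤ ‖mean i - mean j‖ ^ 2 := by
    refine le_trans ?_ (hD i j hj.symm)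
    have h1 : (1 : ℝ) / 2 ≤ 1 - α / 2 := by linarith
    have h2 : d * (2 * lmin) * (1 / 2) ≤ d * (lmax + lmin) * (1 - α / 2) := by
      gcongr
      linarith
    linarith
  have hrD (j : Fin N) (hj : j ≠ i) : 4 * r ≤ ‖mean i - mean j‖ := by
    refine le_of_sq_le_sq ?_ (norm_nonneg _)
    refine le_trans ?_ (hD' j hj)
    rw [mul_pow, hr2, mul_one_div, div_le_iff₀ hβN]
    have h1 : d * (3 * α) ≤ d * s := by gcongr
    have h2 : d * s * 1 ≤ d * s * N := by gcongr
    rw [hs] at h1 h2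
    nlinarith
  have hK : W2 (Phi β X ξ) (X i) ≤
      ENNReal.ofReal (2 * M * (N * Real.exp (-(s * d / 2)))) := by
    refine W2_Phi_multivariateGaussian_le hlmin hβ0 hS hOm hc hX hξ hr0.le hi fun j hj => ⟨?_, ?_⟩
    · linarith [hrD j hj]
    · have h1 := hrD j hj
      have h2 := hD' j hj
      -- Since `4 r ≤ D`, the cross term `2 D r` takes at most half of `D²`.
      have h3 : d * lmin / 2 ≤
          ‖mean i - mean j‖ ^ 2 - 2 * ‖mean i - mean j‖ * r := by
        nlinarith [norm_nonneg (mean i - mean j)]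
      rw [hs]
      nlinarith [mul_le_mul_of_nonneg_left h3 hβ0.le]
  refine hK.trans (ENNReal.ofReal_le_ofReal ?_)
  have h3 : 3 / √(β * N) = 3 * r := by rw [hr]; ring
  rw [h3]
  refine le_of_sq_le_sq ?_ (by positivity)
  have hN3 : (N : ℝ) ^ 3 ≤ Real.exp (s * d / 2) := by
    calc (N : ℝ) ^ 3 ≤ Real.exp (d * α ^ 2 / 16) ^ 3 := by gcongr
      _ = Real.exp (3 * (d * α ^ 2 / 16)) := by rw [← Real.exp_nat_mul]; norm_num
      _ ≤ Real.exp (s * d / 2) := by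
        refine Real.exp_le_exp.2 ?_
        have h1 : 3 * α * d ≤ s * d := by gcongr
        have h2 : d * α * α ≤ d * α * 1 := by gcongr
        nlinarith
  have hx : (s * d) ^ 2 / 8 ≤ Real.exp (s * d / 2) := by
    have := Real.quadratic_le_exp_of_nonneg (x := s * d / 2) (by positivity)
    have h0 : 0 < s * d / 2 := by positivity
    linarith
  have hexp : Real.exp (-(s * d / 2)) ^ 2 * (Real.exp (s * d / 2)) ^ 2 = 1 := by
    rw [← mul_pow, ← Real.exp_add]
    simp
  set e := Real.exp (s * d / 2)
  have he : 0 < e := Real.exp_pos _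
  have hef : Real.exp (-(s * d / 2)) ^ 2 = 1 / e ^ 2 := by
    rw [eq_div_iff (by positivity)]
    exact hexp
  -- One factor `e` absorbs `N³`; here the other absorbs the linear term in `s d`, through the
  -- quadratic lower bound on `exp`.
  have hmain : 4 * (d * (lmax + lmin)) * β ≤ 9 * e := by
    have h1 : 4 * (d * (lmax + lmin)) * β = 4 * (lmax / lmin + 1) * (s * d) := by
      rw [hs]
      field_simp
    have h2 : 2048 * (lmax / lmin + 1) ≤ s * d := by
      have h5 : 3 * α * d ≤ s * d := by gcongr
      linarith
    have h4 : 2048 * (lmax / lmin + 1) * (s * d) ≤ s * d * (s * d) := by gcongr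
    have h6 : 0 < s * d * (s * d) := by positivity
    rw [h1]
    linarith
  calc (2 * M * (N * Real.exp (-(s * d / 2)))) ^ 2 = 4 * M ^ 2 * N ^ 2 * (1 / e ^ 2) := by
        rw [← hef]
        ring
    _ ≤ 4 * (d * (lmax + lmin)) * N ^ 2 * (1 / e ^ 2) := by gcongr
    _ = 4 * (d * (lmax + lmin)) * β * N ^ 3 / e ^ 2 * (1 / (β * N)) := by
        field_simp
    _ ≤ 9 * e * e / e ^ 2 * (1 / (β * N)) := by gcongr
    _ = (3 * r) ^ 2 := by
        rw [mul_pow, hr2]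
        field_simp
        norm_num

/-- The squared mean and the trace each contribute `R² / 2` to the second moment. -/
theorem radiusMax_sq_le {U : Matrix (Fin d) (Fin d) ℝ} {spec : Fin N → EuclideanSpace ℝ (Fin d)}
    (hU : U ∈ Matrix.orthogonalGroup (Fin d) ℝ) (hlmin : 0 < lmin) {R : ℝ}
    (hspec : ∀ j, spec j ∈ spectrumPolytope d R lmin lmax) (hmean : ∀ j, ‖mean j‖ = R / √2)
    (hX : ∀ j, X j = multivariateGaussian (mean j) (covOf U (spec j))) :
    radiusMax X ^ 2 ≤ R ^ 2 := by
  refine (Real.le_sqrt (radiusMax_nonneg X) (sq_nonneg R)).1 ?_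
  refine Real.iSup_le (fun j => Real.le_sqrt_of_sq_le ?_) (Real.sqrt_nonneg _)
  rw [hX j, W2_dirac_zero_toReal_sq _ (covarianceIn_covOf hU hlmin (hspec j).2).1.posSemidef,
    trace_covOf hU, (hspec j).1, hmean j, div_pow, Real.sq_sqrt (by norm_num)]
  linarith

theorem norm_sub_sq_ge {R t : ℝ} {x y : EuclideanSpace ℝ (Fin d)} (hx : ‖x‖ = R / √2)
    (hy : ‖y‖ = R / √2) (h : inner ℝ x y ≤ t * (R / √2) ^ 2) :
    R ^ 2 * (1 - t) ≤ ‖x - y‖ ^ 2 := by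
  rw [norm_sub_sq_real, hx, hy]
  have : (R / √2) ^ 2 = R ^ 2 / 2 := by rw [div_pow, Real.sq_sqrt (by norm_num)]
  rw [this] at h ⊢
  linarith

end HighDimension

/-! ### Size of the number of patterns -/

section NumPatterns

variable {p α : ℝ} {d : ℕ}

theorem numPatterns_le : (numPatterns p α d : ℝ) ≤ √(p / 2) * Real.exp (d * α ^ 2 / 16) :=
  Nat.floor_le (by positivity)

theorem le_two_mul_numPatterns (h : 1 ≤ √(p / 2) * Real.exp (d * α ^ 2 / 16)) :
    1 ≤ numPatterns p α d ∧
      √(p / 2) * Real.exp (d * α ^ 2 / 16) ≤ 2 * (numPatterns p α d : ℝ) := by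
  have h1 : 1 ≤ numPatterns p α d := Nat.one_le_floor_iff _ |>.2 h
  refine ⟨h1, ?_⟩
  have h2 := Nat.lt_floor_add_one (√(p / 2) * Real.exp (d * α ^ 2 / 16))
  have h3 : (1 : ℝ) ≤ numPatterns p α d := by exact_mod_cast h1
  change _ < (numPatterns p α d : ℝ) + 1 at h2
  linarith

/-- The rate `α² / 16` is tuned so that `N²` cancels the cap bound at correlation level `t = α / 2`.
-/
theorem numPatterns_sq_mul_exp_le (hp : 0 < p) :
    (numPatterns p α d : ℝ) ^ 2 * Real.exp (-(d * (α / 2) ^ 2 / 2)) ≤ p := by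
  calc (numPatterns p α d : ℝ) ^ 2 * Real.exp (-(d * (α / 2) ^ 2 / 2))
      ≤ (√(p / 2) * Real.exp (d * α ^ 2 / 16)) ^ 2 * Real.exp (-(d * (α / 2) ^ 2 / 2)) := by
        gcongr
        exact numPatterns_le
    _ = p / 2 := by
        rw [mul_pow, Real.sq_sqrt (by positivity), mul_assoc, ← Real.exp_nat_mul, ← Real.exp_add]
        have : ((2 : ℕ) : ℝ) * (d * α ^ 2 / 16) + -(d * (α / 2) ^ 2 / 2) = 0 := by
          push_cast
          ring
        rw [this, Real.exp_zero, mul_one]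
    _ ≤ p := by linarith

theorem three_div_sqrt_le {a β : ℝ} (ha : 0 < a) (haβ : a < β) (hp : 0 < p)
    (h : 1 ≤ √(p / 2) * Real.exp (d * α ^ 2 / 16)) :
    3 / √(β * numPatterns p α d) ≤
      3 / √(a * √(p / 2) / 2) * Real.exp (-(α ^ 2 / 32) * d) := by
  have h1 := (le_two_mul_numPatterns h).2
  have h2 : √(a * √(p / 2) / 2) * Real.exp (α ^ 2 / 32 * d) ≤ √(β * numPatterns p α d) := by
    refine Real.le_sqrt_of_sq_le ?_
    rw [mul_pow, Real.sq_sqrt (by positivity), ← Real.exp_nat_mul]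
    have h3 : ((2 : ℕ) : ℝ) * (α ^ 2 / 32 * d) = d * α ^ 2 / 16 := by
      push_cast
      ring
    rw [h3]
    calc a * √(p / 2) / 2 * Real.exp (d * α ^ 2 / 16)
        = a * (√(p / 2) * Real.exp (d * α ^ 2 / 16) / 2) := by ring
      _ ≤ β * numPatterns p α d := by
        refine mul_le_mul haβ.le (by linarith) (by positivity) (ha.trans haβ).le
  rw [neg_mul, Real.exp_neg, ← div_eq_mul_inv, div_div]
  gcongr

end NumPatterns

end GaussianDAM

/-! ### The main theorem -/

open GaussianDAM in
theorem theorem3 (lmin lmax : ℝ) (hlmin : 0 < lmin) :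
    -- one-step retrieval for commuting Gaussian patterns
    (∀ (d N : ℕ) (β : ℝ) (mean : Fin N → EuclideanSpace ℝ (Fin d))
        (S : Fin N → Matrix (Fin d) (Fin d) ℝ) (X : Fin N → Measure (EuclideanSpace ℝ (Fin d)))
        (i : Fin N) (m : EuclideanSpace ℝ (Fin d)) (Om : Matrix (Fin d) (Fin d) ℝ)
        (ξ : Measure (EuclideanSpace ℝ (Fin d))),
      0 < β →
      (∀ j, CovarianceIn lmin lmax (S j)) → CovarianceIn lmin lmax Om →
      (∀ j k, Commute (S j) (S k)) → (∀ j, Commute (S j) Om) →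
      (∀ j, X j = multivariateGaussian (mean j) (S j)) → ξ = multivariateGaussian m Om →
      SeparatedAt β lmin lmax X i →
      TemperatureConstraint β lmin lmax X →
      max (144 * β * radiusMax X ^ 2) (1 / (sizeConst lmin lmax X * β)) < N →
      W2 (X i) ξ ≤ ENNReal.ofReal (1 / √(β * N)) →
      W2 (Phi β X ξ) (X i) ≤ ENNReal.ofReal (3 / √(β * N)))
    ∧
    -- exponentially many sampled patterns, hence an exponentially small one-step retrieval error
    (lmin < lmax → lmax / lmin < √(Real.exp 1) →
      ∀ (p : ℝ), 0 < p → p < 1 → ∀ (α : ℝ), α = 1 - 2 * Real.log (lmax / lmin) →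
      ∃ (d₀ : ℕ) (K : ℝ), ∀ (d : ℕ), d₀ < d → ∀ (β : ℝ), 3 * α / lmin < β →
        ∀ (N : ℕ), N = numPatterns p α d →
        3 / √(β * N) ≤ K * Real.exp (-(α ^ 2 / 32) * d) ∧
        ∀ (U : Matrix (Fin d) (Fin d) ℝ), U ∈ Matrix.orthogonalGroup (Fin d) ℝ →
        ∀ (Ω : Type*) [MeasurableSpace Ω] (P : Measure Ω) [IsProbabilityMeasure P]
          (mean spec : Fin N → Ω → EuclideanSpace ℝ (Fin d))
          (X : Ω → Fin N → Measure (EuclideanSpace ℝ (Fin d))),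
        IsSample (√(d * (lmax + lmin))) lmin lmax P mean spec →
        (∀ ω j, X ω j = multivariateGaussian (mean j ω) (covOf U (spec j ω))) →
        ∃ A : Set Ω, MeasurableSet A ∧ ENNReal.ofReal (1 - p) ≤ P A ∧ ∀ ω ∈ A,
          (∀ i, SeparatedAt β lmin lmax (X ω) i) ∧
          TemperatureConstraint β lmin lmax (X ω) ∧
          ∀ (i : Fin N) (m : EuclideanSpace ℝ (Fin d)) (Om : Matrix (Fin d) (Fin d) ℝ)
            (ξ : Measure (EuclideanSpace ℝ (Fin d))),
            CovarianceIn lmin lmax Om → (∀ j, Commute (covOf U (spec j ω)) Om) →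
            ξ = multivariateGaussian m Om →
            W2 (X ω i) ξ ≤ ENNReal.ofReal (1 / √(β * N)) →
            W2 (Phi β (X ω) ξ) (X ω i) ≤ ENNReal.ofReal (3 / √(β * N))) := by
  refine ⟨?_, fun hlmax hγ p hp hp1 α hα => ?_⟩
  · intro d N β mean S X i m Om ξ hβ hS hOm hSS hc hX hξ hsep htemp hN hi
    exact W2_Phi_le_of_separatedAt hlmin hβ hS hOm hSS hc hX hξ hsep htemp
      ((le_max_left _ _).trans_lt hN) hi
  have hγ1 : 1 < lmax / lmin := (one_lt_div hlmin).2 hlmax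
  have hα1 : α < 1 := by linarith [Real.log_pos hγ1]
  have hα0 : 0 < α := by
    have h1 := Real.log_lt_log (by linarith) hγ
    rw [Real.log_sqrt (Real.exp_pos 1).le, Real.log_exp] at h1
    linarith
  have ha : 0 < 3 * α / lmin := by positivity
  -- The first summand makes the argument of the floor at least one, so rounding loses at most a
  -- factor two; the second is the dimension needed for separation and retrieval. `K` carries the
  -- lower bound `3α/λ_min` for `β` and that factor two.
  refine ⟨⌈16 / (α ^ 2 * √(p / 2)) + 2048 * (lmax / lmin + 1) / α ^ 3⌉₊,
    3 / √(3 * α / lmin * √(p / 2) / 2), ?_⟩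
  intro d hd β hβ N hN
  subst hN
  have hd' : 16 / (α ^ 2 * √(p / 2)) + 2048 * (lmax / lmin + 1) / α ^ 3 ≤ d :=
    (Nat.le_ceil _).trans (by exact_mod_cast hd.le)
  have hd1 : 16 / (α ^ 2 * √(p / 2)) ≤ d := le_trans (le_add_of_nonneg_right (by positivity)) hd'
  have hd2 : 2048 * (lmax / lmin + 1) / α ^ 3 ≤ d :=
    le_trans (le_add_of_nonneg_left (by positivity)) hd'
  rw [div_le_iff₀ (by positivity)] at hd1 hd2
  have hdr : (0 : ℝ) < d := by
    have : 0 < d := lt_of_le_of_lt (Nat.zero_le _) hd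
    exact_mod_cast this
  have hdα : 1 ≤ d * α := by
    have h1 : d * α * α ^ 2 ≤ d * α * 1 := by
      gcongr
      exact pow_le_one₀ hα0.le hα1.le
    nlinarith
  have hbig : 1 ≤ √(p / 2) * Real.exp (d * α ^ 2 / 16) := by
    have h1 := Real.add_one_le_exp (d * α ^ 2 / 16)
    have h2 : √(p / 2) * (d * α ^ 2 / 16) ≤ √(p / 2) * Real.exp (d * α ^ 2 / 16) := by
      gcongr
      linarith
    linarith
  obtain ⟨hN1, -⟩ := le_two_mul_numPatterns hbig
  refine ⟨three_div_sqrt_le ha hβ hp hbig, ?_⟩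
  intro U hU Ω _ P _ mean spec X hsample hX
  have hβ' : 3 * α < β * lmin := (div_lt_iff₀ hlmin).1 hβ
  have hβ0 : 0 < β := ha.trans hβ
  have hNle : (numPatterns p α d : ℝ) ≤ Real.exp (d * α ^ 2 / 16) :=
    numPatterns_le.trans (mul_le_of_le_one_left (Real.exp_pos _).le
      (Real.sqrt_le_one.2 (by linarith)))
  have hRpos : 0 < d * (lmax + lmin) := by
    have : 0 < lmax + lmin := by linarith
    positivity
  obtain ⟨A, hA, hPA, hgood⟩ := exists_measurableSet_separated (Real.sqrt_pos.2 hRpos) hsample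
    (t := α / 2) (by positivity) (by nlinarith) (numPatterns_sq_mul_exp_le hp)
  refine ⟨A, hA, hPA, fun ω hω => ?_⟩
  obtain ⟨hspec, hmean, hinner⟩ := hgood ω hω
  have hM := radiusMax_sq_le hU hlmin hspec hmean (hX ω)
  have hD i j (hij : i ≠ j) := norm_sub_sq_ge (hmean i) (hmean j) (hinner i j hij)
  rw [Real.sq_sqrt hRpos.le] at hM hD
  have hS j := covarianceIn_covOf hU hlmin (hspec j).2
  refine ⟨?_, ?_, ?_⟩
  · exact separatedAt_of_large hα0 hα1 hlmin hlmax hα hβ' hd2 hN1 hNle hM hS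
      (fun j k => commute_covOf hU _ _) (hX ω) hD
  · exact temperatureConstraint_of_large hα0 hα1 hlmin hlmax hβ' hdα hN1 hM
  · intro i m Om ξ hOm hc hξ hi
    exact W2_Phi_le_of_large hα0 hα1 hlmin hlmax hβ' hd2 hN1 hNle hM hS (hX ω) hD i hOm hc hξ hi
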